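/- **Setting.** A two-way transducer $\mathcal T$ has a finite state set $Q$, an initial state $q_0$, a set $F\subseteq Q$ of final states, and a finite set of rules $(q,a,v,q',d)$ with $q,q'\in Q$, $a$ an input letter or a delimiter $\vdash,\dashv$, $v$ an output word, and $d\in\{\mathsf{left},\mathsf{right}\}$; there are no left rules on $\vdash$. A successful run on $u=a_1\cdots a_\omega={\vdash}\,w\,{\dashv}$ starts in state $q_0$ with the head on $a_1$ and ends in a final state when the head moves right from $a_\omega$. $\mathcal T$ is functional if all successful runs on the same input have the same output. Let $\rho$ be a successful run. Positions $0,\dots,\omega$ are the cuts between consecutive letters ($x$ lies between $a_x$ and $a_{x+1}$). The initial configuration is at position $0$; a right transition reading $a_x$ leads to position $x$, and a left transition reading $a_{x+1}$ leads to position $x$. The configuration that is the $(y+1)$-th one at position $x$ is the location $(x,y)$, of level $y$. The crossing sequence $\rho|x$ is the sequence of states at $(x,0),(x,1),\dots$. Locations are ordered by $\unlhd$ (strictly: $\lhd$) as they occur in $\rho$. The run is normalized if no two distinct locations have the same position, the same state and levels of the same parity. For a set $Z$ of locations, $\rho\mid Z$ is the sequence of transitions of $\rho$ whose source and target locations are both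 in $Z$, and $\mathrm{out}(\rho\mid Z)$ is the concatenation of their outputs. Intervals of positions are $[x_1,x_2]$ with $0\le x_1<x_2\le\omega$. A factor intercepted by $[x_1,x_2]$ is a maximal non-empty factor of $\rho$ whose transitions all read letters among $a_{x_1+1},\dots,a_{x_2}$. The flow $F_I$ of $I=[x_1,x_2]$ is the graph with nodes $0,\dots,\max(|\rho|x_1|,|\rho|x_2|)-1$ and an edge $(y,y')$ for every intercepted factor from a location of level $y$ to a location of level $y'$, both at position $x_1$ or $x_2$. The effect is $E_I=(F_I,\rho|x_1,\rho|x_2)$. In general, an effect is a triple $(F,c_1,c_2)$ of a graph and two sequences of states of lengths $h_1,h_2\le h_{\max}$ such that each node has at most one incoming and one outgoing edge, an even $y$ has an outgoing edge iff $y<h_1$ and an incoming edge iff $y<h_2$, and an odd $y$ has an incoming edge iff $y<h_1$ and an outgoing edge iff $y<h_2$. Let $F_{LR},F_{RL},F_{LL},F_{RR}$ be the sets of edges even$\to$even, odd$\to$odd, even$\to$odd, odd$\to$even. With relational composition $\cdot$ and reflexive-transitive closure $^*$, the product $F\circ F'$ is the graph with $LR$-part $F_{LR}(F'_{LL}F_{RR})^*F'_{LR}$,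 $RL$-part $F'_{RL}(F_{RR}F'_{LL})^*F_{RL}$, $LL$-part $F_{LL}\cup F_{LR}(F'_{LL}F_{RR})^*F'_{LL}F_{RL}$ and $RR$-part $F'_{RR}\cup F'_{RL}(F_{RR}F'_{LL})^*F_{RR}F'_{LR}$; and $(F,c_1,c_2)\odot(F',c_1',c_2')$ is $(F\circ F',c_1,c_2')$ if $c_2=c_1'$ and this is an effect, and $\bot$ otherwise. A loop is an interval $L=[x_1,x_2]$ with $\rho|x_1=\rho|x_2$; it is idempotent if $E_L\odot E_L=E_L\ (\neq\bot)$. A component $C$ of $L$ is a strongly connected component of $F_L$. Its anchor $\mathrm{an}(C)$ is $(x_1,\max C)$ if $\min C$ is even and $(x_2,\max C)$ if $\min C$ is odd. Its trace $\mathrm{tr}(C)$ (for $L$ idempotent, in which case $C$ is a cycle) is the concatenation of the intercepted factors corresponding to the edges of the cycle $C$, in cycle order starting from $\max C$. Let $c_{\max}$ be the maximal length of the output of a rule, $h_{\max}=2|Q|-1$, $e_{\max}=(2|Q|)^{2h_{\max}}$ and $\boldsymbol B=c_{\max}\cdot h_{\max}\cdot(2^{3e_{\max}}+4)$. **Theorem.**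 Let $\rho$ be a normalized successful run of a functional two-way transducer $\mathcal T$. Let $I=[x_1,x_2]$ be an interval of positions, $K=[\ell_1,\ell_2]$ an interval of locations ($\ell_1\unlhd\ell_2$), and $Z=K\cap(I\times\mathbb N)$. If $|\mathrm{out}(\rho\mid Z)|>\boldsymbol B$, then there exist an idempotent loop $L$ of $\rho$ and a component $C$ of $L$ such that * $x_1<\min(L)<\max(L)<x_2$, * $\ell_1\lhd\mathrm{an}(C)\lhd\ell_2$, * $\mathrm{out}(\mathrm{tr}(C))\neq\varepsilon$. -/

import Mathlib

/-- The two directions in which the head can move. -/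
inductive Dir where
  | left
  | right

/-- Tape symbols: the left delimiter `⊢`, the right delimiter `⊣`, and the input letters. -/
inductive Letter (α : Type*) where
  | lend
  | rend
  | sym (a : α)

/-- A transition rule `(q, a, w, q', d)`. -/
structure Rule (Q α β : Type*) where
  src : Q
  letter : Letter α
  out : List β
  tgt : Q
  dir : Dir

/-- Two-way transducers with states `Q`, input alphabet `α`, output alphabet `β`. The set of rules
is finite, and no rule moves left on the left delimiter. -/
structure TwoWayTransducer (Q α β : Type*) where
  rules : Finset (Rule Q α β)
  start : Q
  final : Set Q
  no_left : ∀ t ∈ rules, t.letter = Letter.lend → t.dir = Dir.right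

/-- The delimited input `⊢ w ⊣`. -/
def tape {α : Type*} (w : List α) : List (Letter α) :=
  Letter.lend :: (w.map Letter.sym ++ [Letter.rend])

/-- On a fixed delimited input, the configuration `u q v` is given by `head = |u|` and
`state = q`; the head reads the first symbol of `v`, i.e. entry `head` of the tape, counting
from `0`. -/
structure Config (Q : Type*) where
  head : ℕ
  state : Q

namespace TwoWayTransducer

variable {Q α β : Type*} (T : TwoWayTransducer Q α β)

/-- `c → c'` on input `w` by means of the rule `t`. -/
def Step (w : List α) (c : Config Q) (t : Rule Q α β) (c' : Config Q) : Prop :=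
  t ∈ T.rules ∧ t.src = c.state ∧ t.tgt = c'.state ∧ (tape w)[c.head]? = some t.letter ∧
    match t.dir with
    | Dir.right => c'.head = c.head + 1
    | Dir.left => c.head = c'.head + 1

/-- The capacity `c_max`: the maximal length of the output of a transition. -/
def cmax : ℕ := T.rules.sup fun t => t.out.length

end TwoWayTransducer

/-- `h_max = 2|Q| - 1`. -/
def hmax (Q : Type*) [Fintype Q] : ℕ := 2 * Fintype.card Q - 1

/-- `e_max = (2|Q|)^(2 h_max)`. -/
def emax (Q : Type*) [Fintype Q] : ℕ := (2 * Fintype.card Q) ^ (2 * hmax Q)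

/-- `B = c_max · h_max · (2^(3 e_max) + 4)`. -/
def TwoWayTransducer.bound {Q α β : Type*} [Fintype Q] (T : TwoWayTransducer Q α β) : ℕ :=
  T.cmax * hmax Q * (2 ^ (3 * emax Q) + 4)

/-- A run on `⊢ w ⊣` with `len` transitions: transition number `i < len` leads from configuration
`conf i` to configuration `conf (i + 1)` by the rule `rule i`. Values of `conf` beyond `len`, and
of `rule` from `len` on, have no meaning. -/
structure Run {Q α β : Type*} (T : TwoWayTransducer Q α β) (w : List α) where
  len : ℕ
  conf : ℕ → Config Q
  rule : ℕ → Rule Q α β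
  step : ∀ i < len, T.Step w (conf i) (rule i) (conf (i + 1))

/-- The output of a sequence of transitions. -/
def outputOf {Q α β : Type*} (τ : List (Rule Q α β)) : List β := τ.flatMap fun t => t.out

/-- An effect candidate: the edge relation of a flow, and the crossing sequences at the left and
right border. The nodes of the flow are the numbers below the maximum of the two lengths. -/
structure Effect (Q : Type*) where
  flow : ℕ → ℕ → Prop
  left : List Q
  right : List Q

namespace Effect

/-- The effects proper: crossing sequences of length at most `h_max`, and the in-degree and
out-degree conditions on flows. These confine all edges to the nodes of the flow. -/
structure IsValid {Q : Type*} [Fintype Q] (E : Effect Q) : Prop where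
  left_le : E.left.length ≤ hmax Q
  right_le : E.right.length ≤ hmax Q
  out_unique : ∀ y z z', E.flow y z → E.flow y z' → z = z'
  in_unique : ∀ y y' z, E.flow y z → E.flow y' z → y = y'
  even_out : ∀ y, Even y → ((∃ z, E.flow y z) ↔ y < E.left.length)
  odd_in : ∀ y, Odd y → ((∃ z, E.flow z y) ↔ y < E.left.length)
  even_in : ∀ y, Even y → ((∃ z, E.flow z y) ↔ y < E.right.length)
  odd_out : ∀ y, Odd y → ((∃ z, E.flow y z) ↔ y < E.right.length)

end Effect

/-- Edges between even nodes. -/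
def flowLR (F : ℕ → ℕ → Prop) (y z : ℕ) : Prop := F y z ∧ Even y ∧ Even z

/-- Edges between odd nodes. -/
def flowRL (F : ℕ → ℕ → Prop) (y z : ℕ) : Prop := F y z ∧ Odd y ∧ Odd z

/-- Edges from an even node to an odd node. -/
def flowLL (F : ℕ → ℕ → Prop) (y z : ℕ) : Prop := F y z ∧ Even y ∧ Odd z

/-- Edges from an odd node to an even node. -/
def flowRR (F : ℕ → ℕ → Prop) (y z : ℕ) : Prop := F y z ∧ Odd y ∧ Even z

/-- The graph whose `LR`, `RL`, `LL`, `RR` parts are those prescribed for the product `F ∘ F'`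
(each of the four disjuncts only has edges of the respective parity type). -/
def flowComp (F F' : ℕ → ℕ → Prop) (y z : ℕ) : Prop :=
  Relation.Comp (flowLR F)
    (Relation.Comp (Relation.ReflTransGen (Relation.Comp (flowLL F') (flowRR F)))
      (flowLR F')) y z ∨
  Relation.Comp (flowRL F')
    (Relation.Comp (Relation.ReflTransGen (Relation.Comp (flowRR F) (flowLL F')))
      (flowRL F)) y z ∨
  (flowLL F y z ∨
    Relation.Comp (flowLR F)
      (Relation.Comp (Relation.ReflTransGen (Relation.Comp (flowLL F') (flowRR F)))
        (Relation.Comp (flowLL F') (flowRL F))) y z) ∨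
  (flowRR F' y z ∨
    Relation.Comp (flowRL F')
      (Relation.Comp (Relation.ReflTransGen (Relation.Comp (flowRR F) (flowLL F')))
        (Relation.Comp (flowRR F) (flowLR F'))) y z)

open Classical in
/-- The product `E ⊙ E'`, where `none` is the dummy element `⊥`. -/
noncomputable def Effect.mul {Q : Type*} [Fintype Q] (E E' : Effect Q) : Option (Effect Q) :=
  if E.right = E'.left ∧ Effect.IsValid ⟨flowComp E.flow E'.flow, E.left, E'.right⟩ then
    some ⟨flowComp E.flow E'.flow, E.left, E'.right⟩
  else none

namespace Run

variable {Q α β : Type*} {T : TwoWayTransducer Q α β} {w : List α} (ρ : Run T w)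

/-- The transitions of `ρ` numbered `i, ..., j - 1`. -/
def factor (i j : ℕ) : List (Rule Q α β) := (List.Ico i j).map ρ.rule

/-- The output of the whole run. -/
def output : List β := outputOf (ρ.factor 0 ρ.len)

/-- The run leads from the initial configuration `q₀ w` to a configuration `w q` with `q` final. -/
def Successful : Prop :=
  ρ.conf 0 = ⟨0, T.start⟩ ∧
    ∃ q ∈ T.final, ρ.conf ρ.len = ⟨(tape w).length, q⟩

/-- The position (cut between tape cells) of the `i`-th location of the run. The run starts at
position `0`. A right transition from head position `h` (which reads the symbol number `h + 1`,
counting from `1`, and moves to head position `h + 1`) crosses the cut `h + 1`; a left transition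
from head position `h` crosses the cut `h`. -/
def pos : ℕ → ℕ
  | 0 => (ρ.conf 0).head
  | i + 1 =>
    match (ρ.rule i).dir with
    | Dir.right => (ρ.conf i).head + 1
    | Dir.left => (ρ.conf i).head

/-- The level of the `i`-th location: the number of earlier visits to the same position. -/
def level (i : ℕ) : ℕ := ((Finset.range i).filter fun j => ρ.pos j = ρ.pos i).card

/-- The `i`-th location visited by the run, for `i ≤ len`. -/
def loc (i : ℕ) : ℕ × ℕ := (ρ.pos i, ρ.level i)

/-- The crossing sequence at position `x`: the states at the locations `(x, 0), (x, 1), ...`. -/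
def crossing (x : ℕ) : List Q :=
  ((List.range (ρ.len + 1)).filter fun i => ρ.pos i = x).map fun i => (ρ.conf i).state

/-- The run never visits two locations with the same position, state and parity of the level. -/
def Normalized : Prop :=
  ∀ i ≤ ρ.len, ∀ j ≤ ρ.len, ρ.pos i = ρ.pos j → (ρ.conf i).state = (ρ.conf j).state →
    (Even (ρ.level i) ↔ Even (ρ.level j)) → i = j

/-- The run order `⊴` on locations. -/
def Le (l l' : ℕ × ℕ) : Prop :=
  ∃ i j, i ≤ j ∧ j ≤ ρ.len ∧ ρ.loc i = l ∧ ρ.loc j = l'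

/-- The strict run order `⊲` on locations. -/
def Lt (l l' : ℕ × ℕ) : Prop :=
  ∃ i j, i < j ∧ j ≤ ρ.len ∧ ρ.loc i = l ∧ ρ.loc j = l'

/-- The interval of locations `[l₁, l₂]`. -/
def locInterval (l₁ l₂ : ℕ × ℕ) : Set (ℕ × ℕ) := {l | ρ.Le l₁ l ∧ ρ.Le l l₂}

open Classical in
/-- The restriction `ρ ∣ Z`: the sequence of those transitions of `ρ` whose source and target
locations both lie in `Z`. -/
noncomputable def restrict (Z : Set (ℕ × ℕ)) : List (Rule Q α β) :=
  ((List.range ρ.len).filter fun i => ρ.loc i ∈ Z ∧ ρ.loc (i + 1) ∈ Z).map ρ.rule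

/-- Transition number `i` takes place inside the interval of positions `[x₁, x₂]`: the symbol that
it reads lies between the cuts `x₁` and `x₂`. -/
def Inside (x₁ x₂ i : ℕ) : Prop := x₁ ≤ (ρ.conf i).head ∧ (ρ.conf i).head < x₂

/-- The factor between the `i`-th and the `j`-th location is intercepted by `[x₁, x₂]`: it is a
maximal (non-empty) factor all of whose transitions take place inside `[x₁, x₂]`. -/
def Intercepted (x₁ x₂ i j : ℕ) : Prop :=
  i < j ∧ j ≤ ρ.len ∧ (∀ k, i ≤ k → k < j → ρ.Inside x₁ x₂ k) ∧
    (0 < i → ¬ ρ.Inside x₁ x₂ (i - 1)) ∧ (j < ρ.len → ¬ ρ.Inside x₁ x₂ j)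

/-- The factor between the `i`-th and the `j`-th location is intercepted by `[x₁, x₂]` and
corresponds to the edge `(y, z)` of the flow. -/
def EdgeFactor (x₁ x₂ y z i j : ℕ) : Prop :=
  ρ.Intercepted x₁ x₂ i j ∧
    (ρ.loc i = (x₁, y) ∨ ρ.loc i = (x₂, y)) ∧ (ρ.loc j = (x₁, z) ∨ ρ.loc j = (x₂, z))

/-- The edges of the flow of `[x₁, x₂]`. -/
def flow (x₁ x₂ y z : ℕ) : Prop := ∃ i j, ρ.EdgeFactor x₁ x₂ y z i j

/-- The effect of `[x₁, x₂]`. -/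
def effect (x₁ x₂ : ℕ) : Effect Q := ⟨ρ.flow x₁ x₂, ρ.crossing x₁, ρ.crossing x₂⟩

/-- `[x₁, x₂]` is an interval of positions. -/
def IsInterval (_ρ : Run T w) (x₁ x₂ : ℕ) : Prop := x₁ < x₂ ∧ x₂ ≤ (tape w).length

/-- `[x₁, x₂]` is a loop. -/
def IsLoop (x₁ x₂ : ℕ) : Prop := ρ.IsInterval x₁ x₂ ∧ ρ.crossing x₁ = ρ.crossing x₂

/-- `[x₁, x₂]` is an idempotent loop. -/
def IsIdempotentLoop [Fintype Q] (x₁ x₂ : ℕ) : Prop :=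
  ρ.IsLoop x₁ x₂ ∧ (ρ.effect x₁ x₂).mul (ρ.effect x₁ x₂) = some (ρ.effect x₁ x₂)

/-- `C` is the node set of a strongly connected component of the flow of `[x₁, x₂]`. -/
def IsComponent (x₁ x₂ : ℕ) (C : Set ℕ) : Prop :=
  ∃ y < max (ρ.crossing x₁).length (ρ.crossing x₂).length,
    C = {z | Relation.ReflTransGen (ρ.flow x₁ x₂) y z ∧ Relation.ReflTransGen (ρ.flow x₁ x₂) z y}

/-- `τ` is the trace of the component `C` inside the loop `[x₁, x₂]`: `node 0, ..., node (k + 1)`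
runs once through the cycle `C`, starting and ending at the maximum of `C`, and `τ` is the
concatenation of the intercepted factors that correspond to the edges of this cycle. -/
def IsTrace (x₁ x₂ : ℕ) (C : Set ℕ) (τ : List (Rule Q α β)) : Prop :=
  ∃ (k : ℕ) (node src tgt : ℕ → ℕ),
    node 0 = sSup C ∧ node (k + 1) = sSup C ∧
    Set.BijOn node (Set.Iic k) C ∧
    (∀ j ≤ k, ρ.EdgeFactor x₁ x₂ (node j) (node (j + 1)) (src j) (tgt j)) ∧
    τ = (List.range (k + 1)).flatMap fun j => ρ.factor (src j) (tgt j)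

end Run

open Classical in
/-- The anchor of the component `C` inside the loop `[x₁, x₂]`: the component is left-to-right if
its minimum is even, and right-to-left otherwise. -/
noncomputable def anchor (x₁ x₂ : ℕ) (C : Set ℕ) : ℕ × ℕ :=
  if Even (sInf C) then (x₁, sSup C) else (x₂, sSup C)

/-- For each input, all successful runs have the same output. -/
def TwoWayTransducer.Functional {Q α β : Type*} (T : TwoWayTransducer Q α β) : Prop :=
  ∀ (w : List α) (ρ ρ' : Run T w), ρ.Successful → ρ'.Successful → ρ.output = ρ'.output

/-!
Many productive transitions read many tape cells, since a normalized run reads each cell boundedly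
often. The number of traversals of an interval between two of these cells can only drop when the
interval grows, so it is constant on the intervals with borders in a large subset, and then the
levels at which the traversals meet a border depend on that border only. Traversals do not cross,
and a factor that turns back leads from its level to the next one; hence the crossing sequences
and the border levels determine the flow. By pigeonhole there are seven borders that share the
crossing sequence and such that any two of them have the same flow `F`.

Having the same flow on two adjacent intervals and on their union makes `F` idempotent and its
components intervals `Icc m M`: the traversing edge `M → m` can be followed by a climb from `m`
back to `M` by turns. Between the middle two of four borders `a < b < c < d` a productive
transition must lie on a traversal of `[a, d]`, whose start is the anchor of a productive
component. Two such quadruples that share a border provide two anchors, and one of them lies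
strictly between `ℓ₁` and `ℓ₂`.
-/

section Order

variable {α : Type*}

/-- Mirsky's theorem: elements of the same height are incomparable. -/
theorem exists_chain_or_antichain_of_mul_lt_card {r : α → α → Prop} [IsStrictOrder α r]
    {S : Finset α} {q n : ℕ} (hS : q * n < S.card) :
    (∃ U ⊆ S, q < U.card ∧ IsChain r (U : Set α)) ∨
      ∃ U ⊆ S, n < U.card ∧ IsAntichain r (U : Set α) := by
  classical
  let chainsTo (x : α) : Finset (Finset α) :=
    S.powerset.filter fun U => x ∈ U ∧ (∀ y ∈ U, y = x ∨ r y x) ∧ IsChain r (U : Set α)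
  let height (x : α) : ℕ := (chainsTo x).sup Finset.card
  by_cases hq : ∃ x ∈ S, q < height x
  · obtain ⟨x, -, hx⟩ := hq
    obtain ⟨U, hU, hcard⟩ := (Finset.lt_sup_iff).1 hx
    simp only [chainsTo, Finset.mem_filter, Finset.mem_powerset] at hU
    exact .inl ⟨U, hU.1, hcard, hU.2.2.2⟩
  push Not at hq
  have height_pos : ∀ x ∈ S, 1 ≤ height x := fun x hx =>
    Finset.le_sup (f := Finset.card) (b := {x}) (by simp [chainsTo, hx])
  have height_lt : ∀ x, ∀ y ∈ S, r x y → height x < height y := by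
    intro x y hy hxy
    refine (Finset.sup_lt_iff (height_pos y hy)).2 fun U hU => ?_
    simp only [chainsTo, Finset.mem_filter, Finset.mem_powerset] at hU
    obtain ⟨hUS, -, hUx, hU⟩ := hU
    have hUy : ∀ z ∈ U, r z y := fun z hz =>
      (hUx z hz).elim (fun h => h ▸ hxy) fun h => _root_.trans h hxy
    have hyU : y ∉ U := fun h => irrefl y (hUy y h)
    rw [← Nat.succ_le_iff, Nat.succ_eq_add_one, ← Finset.card_insert_of_notMem hyU]
    refine Finset.le_sup (f := Finset.card) ?_
    simp only [chainsTo, Finset.mem_filter, Finset.mem_powerset, Finset.coe_insert]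
    refine ⟨Finset.insert_subset hy hUS, Finset.mem_insert_self y U, fun z hz => ?_,
      hU.insert fun z hz _ => .inr (hUy z hz)⟩
    exact (Finset.mem_insert.1 hz).imp_right (hUy z)
  obtain ⟨k, -, hk⟩ := Finset.exists_lt_card_fiber_of_mul_lt_card_of_maps_to
    (t := Finset.Icc 1 q) (f := height)
    (fun x hx => Finset.mem_Icc.2 ⟨height_pos x hx, hq x hx⟩) (by simpa using hS)
  refine .inr ⟨_, Finset.filter_subset _ _, hk, fun x hx y hy _ hxy => ?_⟩
  simp only [Finset.coe_filter, Set.mem_ofPred_eq] at hx hy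
  exact (height_lt x y hy.1 hxy).ne (hx.2.trans hy.2.symm)

theorem exists_subset_constant_on_pairs [LinearOrder α] {g : α → α → ℕ} {q : ℕ} (H : ℕ)
    {v : ℕ} {S : Finset α} (hS : q ^ H < S.card)
    (hg : ∀ x ∈ S, ∀ y ∈ S, ∀ z ∈ S, x < y → y < z → g x z ≤ g x y)
    (hv : ∀ x ∈ S, ∀ y ∈ S, x < y → v ≤ g x y ∧ g x y < v + H) :
    ∃ U ⊆ S, q < U.card ∧ ∃ c, ∀ x ∈ U, ∀ y ∈ U, x < y → g x y = c := by
  induction H generalizing v S with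
  | zero =>
    obtain ⟨x, hx, y, hy, hne⟩ := Finset.one_lt_card.1 (by simpa using hS)
    rcases lt_or_gt_of_ne hne with h | h
    · have := hv x hx y hy h; omega
    · have := hv y hy x hx h; omega
  | succ H ih =>
    let r (x y : α) : Prop := x ∈ S ∧ y ∈ S ∧ x < y ∧ g x y = v
    have : IsStrictOrder α r :=
      { irrefl := fun x h => h.2.2.1.false
        trans := fun x y z ⟨hx, hy, hxy, hv'⟩ ⟨_, hz, hyz, _⟩ =>
          ⟨hx, hz, hxy.trans hyz, le_antisymm (hv' ▸ hg x hx y hy z hz hxy hyz)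
            (hv x hx z hz (hxy.trans hyz)).1⟩ }
    rcases exists_chain_or_antichain_of_mul_lt_card (r := r) (by rwa [← pow_succ']) with
      ⟨U, hUS, hcard, hU⟩ | ⟨U, hUS, hcard, hU⟩
    · refine ⟨U, hUS, hcard, v, fun x hx y hy hxy => ?_⟩
      exact (hU hx hy hxy.ne).elim (fun h => h.2.2.2) fun h => absurd h.2.2.1 hxy.asymm
    · have hv' : ∀ x ∈ U, ∀ y ∈ U, x < y → v + 1 ≤ g x y ∧ g x y < v + 1 + H := by
        intro x hx y hy hxy
        have hne : g x y ≠ v := fun h => hU hx hy hxy.ne ⟨hUS hx, hUS hy, hxy, h⟩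
        have := hv x (hUS hx) y (hUS hy) hxy
        omega
      obtain ⟨V, hVU, hV⟩ := ih hcard
        (fun x hx y hy z hz => hg x (hUS hx) y (hUS hy) z (hUS hz)) hv'
      exact ⟨V, hVU.trans hUS, hV⟩

/-- Relations whose pairs are ordered in the same way by their first and by their second
components, that is, graphs of strictly increasing partial functions; the traversals of an interval
by a run relate their levels at the two borders in this way. -/
def StrictMonoRel {α β : Type*} [LT α] [LT β] (R : α → β → Prop) : Prop :=
  ∀ ⦃a b a' b'⦄, R a b → R a' b' → (a < a' ↔ b < b')

namespace StrictMonoRel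

variable {β : Type*} [LinearOrder α] [LinearOrder β] {R R' : α → β → Prop}

theorem eq_iff (hR : StrictMonoRel R) {a a' : α} {b b' : β} (h : R a b) (h' : R a' b') :
    a = a' ↔ b = b' := by
  have h1 := hR h h'
  have h2 := hR h' h
  simp only [eq_iff_le_not_lt, ← not_lt, h1, h2]

theorem ncard_domain_eq (hR : StrictMonoRel R) :
    {a | ∃ b, R a b}.ncard = {b | ∃ a, R a b}.ncard := by
  refine Set.ncard_congr (fun a ha => ha.choose) (fun a ha => ⟨a, ha.choose_spec⟩)
    (fun a a' ha ha' h => ?_) fun b ⟨a, ha⟩ => ⟨a, ⟨b, ha⟩, ?_⟩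
  · exact (hR.eq_iff ha.choose_spec ha'.choose_spec).2 h
  · exact (hR.eq_iff (Exists.choose_spec (⟨b, ha⟩ : ∃ b, R a b)) ha).1 rfl

theorem le_of_domain_eq [WellFoundedLT α] (hR : StrictMonoRel R) (hR' : StrictMonoRel R')
    (hdom : ∀ a, (∃ b, R a b) ↔ ∃ b, R' a b) (hran : ∀ b, (∃ a, R a b) ↔ ∃ a, R' a b) :
    R ≤ R' := by
  intro a b h
  induction a using WellFoundedLT.induction generalizing b with
  | ind a ih =>
    obtain ⟨b', h'⟩ := (hdom a).1 ⟨b, h⟩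
    obtain ⟨a', ha'⟩ := (hran b).1 ⟨a, h⟩
    rcases lt_trichotomy b b' with hlt | rfl | hlt
    · obtain ⟨b'', hb''⟩ := (hdom a').2 ⟨b, ha'⟩
      have ha'a : a' < a := (hR' ha' h').2 hlt
      have hbb'' := (hR'.eq_iff (ih a' ha'a _ hb'') ha').1 rfl
      exact absurd ((hR.eq_iff (hbb'' ▸ hb'') h).2 rfl) ha'a.ne
    · exact h'
    · obtain ⟨a'', ha''⟩ := (hran b').2 ⟨a, h'⟩
      have ha''a : a'' < a := (hR ha'' h).2 hlt
      exact absurd ((hR'.eq_iff (ih a'' ha''a _ ha'') h').2 rfl) ha''a.ne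

theorem eq_of_domain_eq [WellFoundedLT α] (hR : StrictMonoRel R) (hR' : StrictMonoRel R')
    (hdom : ∀ a, (∃ b, R a b) ↔ ∃ b, R' a b) (hran : ∀ b, (∃ a, R a b) ↔ ∃ a, R' a b) :
    R = R' :=
  le_antisymm (hR.le_of_domain_eq hR' hdom hran)
    (hR'.le_of_domain_eq hR (fun a => (hdom a).symm) fun b => (hran b).symm)

end StrictMonoRel

end Order

section Flow

variable {F : ℕ → ℕ → Prop} {m u v y : ℕ}

/-- The traversing edges of a flow, as a relation between the levels of their ends at the left and
at the right border. -/
def Traverses (F : ℕ → ℕ → Prop) (l r : ℕ) : Prop := flowLR F l r ∨ flowRL F r l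

/-- The levels of the ends of traversing edges at the left border. -/
def leftLevels (F : ℕ → ℕ → Prop) : Set ℕ := {l | ∃ r, Traverses F l r}

/-- The levels of the ends of traversing edges at the right border. -/
def rightLevels (F : ℕ → ℕ → Prop) : Set ℕ := {r | ∃ l, Traverses F l r}

/-- The flow contains the path `m → m + 1 → ⋯ → u`. -/
def Climbs (F : ℕ → ℕ → Prop) (m u : ℕ) : Prop := m ≤ u ∧ ∀ y, m ≤ y → y < u → F y (y + 1)

/-- Two properties of the flows of runs: nodes have at most one outgoing edge, and turning edges
lead to the next level. -/
structure AscendingFlow (F : ℕ → ℕ → Prop) : Prop where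
  out_unique : ∀ u v v', F u v → F u v' → v = v'
  turn : ∀ u v, F u v → ¬(Even u ↔ Even v) → v = u + 1

/-- Flows in which every traversing edge `M → m` closes a cycle `m → m + 1 → ⋯ → M → m`. -/
structure CyclicFlow (F : ℕ → ℕ → Prop) : Prop extends AscendingFlow F where
  climbs : ∀ u v, F u v → (Even u ↔ Even v) → Climbs F v u

theorem reflTransGen_comp_of_succ {R S : ℕ → ℕ → Prop} {n : ℕ}
    (hR : ∀ k < n, R (m + 2 * k) (m + 2 * k + 1))
    (hS : ∀ k < n, S (m + 2 * k + 1) (m + 2 * k + 2)) :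
    Relation.ReflTransGen (Relation.Comp R S) m (m + 2 * n) := by
  induction n with
  | zero => exact .refl
  | succ n ih =>
    exact (ih (fun k hk => hR k (by omega)) fun k hk => hS k (by omega)).tail
      ⟨_, hR n (by omega), hS n (by omega)⟩

theorem iff_traverses_of_even_iff (hp : Even u ↔ Even v) :
    F u v ↔ if Even u then Traverses F u v else Traverses F v u := by
  by_cases hu : Even u
  · simp [Traverses, flowLR, flowRL, hu, hp.1 hu]
  · have hv : Odd v := Nat.not_even_iff_odd.1 (hp.not.1 hu)
    simp [Traverses, flowLR, flowRL, hu, Nat.not_even_iff_odd.1 hu, hv]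

namespace Climbs

theorem reflTransGen (h : Climbs F m u) : Relation.ReflTransGen F m u :=
  reflTransGen_of_succ_of_le _ (fun y hy => h.2 y hy.1 hy.2) h.1

theorem reflTransGen_flowLL_flowRR (h : Climbs F m u) (hm : Even m) (hu : Even u) :
    Relation.ReflTransGen (Relation.Comp (flowLL F) (flowRR F)) m u := by
  obtain ⟨n, rfl⟩ : ∃ n, u = m + 2 * n := ⟨(u - m) / 2, by have := h.1; grind⟩
  exact reflTransGen_comp_of_succ
    (fun k hk => ⟨h.2 _ (by omega) (by omega), by grind, by grind⟩)
    fun k hk => ⟨h.2 _ (by omega) (by omega), by grind, by grind⟩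

theorem reflTransGen_flowRR_flowLL (h : Climbs F m u) (hm : Odd m) (hu : Odd u) :
    Relation.ReflTransGen (Relation.Comp (flowRR F) (flowLL F)) m u := by
  obtain ⟨n, rfl⟩ : ∃ n, u = m + 2 * n := ⟨(u - m) / 2, by have := h.1; grind⟩
  exact reflTransGen_comp_of_succ
    (fun k hk => ⟨h.2 _ (by omega) (by omega), by grind, by grind⟩)
    fun k hk => ⟨h.2 _ (by omega) (by omega), by grind, by grind⟩

theorem succ (h : Climbs F m u) (hu : F u (u + 1)) : Climbs F m (u + 1) :=
  ⟨h.1.trans u.le_succ, fun y hmy hy =>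
    (Nat.lt_succ_iff_lt_or_eq.1 hy).elim (h.2 y hmy) fun e => e ▸ hu⟩

theorem eq_of_not_succ (h : Climbs F m u) (h' : Climbs F m y) (hu : ¬F u (u + 1))
    (hy : ¬F y (y + 1)) : u = y := by
  rcases lt_trichotomy u y with hlt | rfl | hlt
  · exact absurd (h'.2 u h.1 hlt) hu
  · rfl
  · exact absurd (h.2 y h'.1 hlt) hy

end Climbs

theorem climbs_of_reflTransGen_comp {R S : ℕ → ℕ → Prop}
    (hR : ∀ u v, R u v → F u v ∧ v = u + 1) (hS : ∀ u v, S u v → F u v ∧ v = u + 1)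
    (h : Relation.ReflTransGen (Relation.Comp R S) m u) : Climbs F m u := by
  induction h with
  | refl => exact ⟨le_rfl, fun y hm hy => absurd hy hm.not_gt⟩
  | tail _ hbc ih =>
    obtain ⟨p, hbp, hpc⟩ := hbc
    obtain ⟨hbp, rfl⟩ := hR _ _ hbp
    obtain ⟨hpc, rfl⟩ := hS _ _ hpc
    exact (ih.succ hbp).succ hpc

namespace AscendingFlow

theorem not_succ_of_parity_iff (h : AscendingFlow F) (huv : F u v) (hp : Even u ↔ Even v) :
    ¬F u (u + 1) := fun hu => by
  have := h.out_unique _ _ _ huv hu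
  grind

theorem climbs_of_reflTransGen_flowLL_flowRR (h : AscendingFlow F)
    (hu : Relation.ReflTransGen (Relation.Comp (flowLL F) (flowRR F)) m u) : Climbs F m u :=
  climbs_of_reflTransGen_comp (fun _ _ e => ⟨e.1, h.turn _ _ e.1 (by grind [flowLL])⟩)
    (fun _ _ e => ⟨e.1, h.turn _ _ e.1 (by grind [flowRR])⟩) hu

theorem climbs_of_reflTransGen_flowRR_flowLL (h : AscendingFlow F)
    (hu : Relation.ReflTransGen (Relation.Comp (flowRR F) (flowLL F)) m u) : Climbs F m u :=
  climbs_of_reflTransGen_comp (fun _ _ e => ⟨e.1, h.turn _ _ e.1 (by grind [flowRR])⟩)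
    (fun _ _ e => ⟨e.1, h.turn _ _ e.1 (by grind [flowLL])⟩) hu

theorem le_of_traverses {F' : ℕ → ℕ → Prop} (h : AscendingFlow F) (h' : AscendingFlow F')
    (hdom : ∀ u, (∃ v, F u v) → ∃ v, F' u v) (htr : Traverses F = Traverses F') : F ≤ F' := by
  have parity_iff (u v : ℕ) (hp : Even u ↔ Even v) : F u v ↔ F' u v := by
    rw [iff_traverses_of_even_iff (F := F) hp, iff_traverses_of_even_iff (F := F') hp, htr]
  intro u v huv
  by_cases hp : Even u ↔ Even v
  · exact (parity_iff u v hp).1 huv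
  obtain ⟨v', hv'⟩ := hdom u ⟨v, huv⟩
  by_cases hp' : Even u ↔ Even v'
  · have := h.out_unique _ _ _ huv ((parity_iff u v' hp').2 hv')
    exact absurd (this ▸ hp') hp
  · rwa [h.turn u v huv hp, ← h'.turn u v' hv' hp']

theorem eq_of_traverses {F' : ℕ → ℕ → Prop} (h : AscendingFlow F) (h' : AscendingFlow F')
    (hdom : ∀ u, (∃ v, F u v) ↔ ∃ v, F' u v) (htr : Traverses F = Traverses F') : F = F' :=
  le_antisymm (h.le_of_traverses h' (fun u => (hdom u).1) htr)
    (h'.le_of_traverses h (fun u => (hdom u).2) htr.symm)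

end AscendingFlow

namespace CyclicFlow

theorem eq_of_climbs (h : CyclicFlow F) (huv : F u v) (hp : Even u ↔ Even v)
    (hy : Climbs F v y) (hy' : ¬F y (y + 1)) : y = u :=
  hy.eq_of_not_succ (h.climbs u v huv hp) hy' (h.not_succ_of_parity_iff huv hp)

theorem flowComp_self_le (h : CyclicFlow F) : flowComp F F ≤ F := by
  rintro y z (⟨m, ⟨hym, hy, hm⟩, u, hmu, huz, hu, hz⟩ | ⟨m, ⟨hym, hy, hm⟩, u, hmu, huz, hu, hz⟩ |
    (hyz | ⟨m, ⟨hym, hy, hm⟩, u, hmu, p, ⟨hup, hu, hp⟩, hpz, -, hz⟩) |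
    (hyz | ⟨m, ⟨hym, hy, hm⟩, u, hmu, p, ⟨hup, hu, hp⟩, hpz, -, hz⟩))
  · have := h.eq_of_climbs hym (by grind) (h.climbs_of_reflTransGen_flowLL_flowRR hmu)
      (h.not_succ_of_parity_iff huz (by grind))
    exact this ▸ huz
  · have := h.eq_of_climbs hym (by grind) (h.climbs_of_reflTransGen_flowRR_flowLL hmu)
      (h.not_succ_of_parity_iff huz (by grind))
    exact this ▸ huz
  · exact hyz.1
  · obtain rfl := h.turn u p hup (by grind)
    have := h.eq_of_climbs hym (by grind) ((h.climbs_of_reflTransGen_flowLL_flowRR hmu).succ hup)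
      (h.not_succ_of_parity_iff hpz (by grind))
    grind
  · exact hyz.1
  · obtain rfl := h.turn u p hup (by grind)
    have := h.eq_of_climbs hym (by grind) ((h.climbs_of_reflTransGen_flowRR_flowLL hmu).succ hup)
      (h.not_succ_of_parity_iff hpz (by grind))
    grind

theorem le_flowComp_self (h : CyclicFlow F) : F ≤ flowComp F F := by
  intro y z hyz
  rcases y.even_or_odd with hy | hy <;> rcases z.even_or_odd with hz | hz
  · exact .inl ⟨z, ⟨hyz, hy, hz⟩, y,
      (h.climbs y z hyz (by grind)).reflTransGen_flowLL_flowRR hz hy, hyz, hy, hz⟩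
  · exact .inr (.inr (.inl (.inl ⟨hyz, hy, hz⟩)))
  · exact .inr (.inr (.inr (.inl ⟨hyz, hy, hz⟩)))
  · exact .inr (.inl ⟨z, ⟨hyz, hy, hz⟩, y,
      (h.climbs y z hyz (by grind)).reflTransGen_flowRR_flowLL hz hy, hyz, hy, hz⟩)

theorem flowComp_self (h : CyclicFlow F) : flowComp F F = F :=
  le_antisymm h.flowComp_self_le h.le_flowComp_self

theorem setOf_mutually_reachable_eq_Icc (h : CyclicFlow F) (huv : F u v) (hp : Even u ↔ Even v) :
    {z | Relation.ReflTransGen F u z ∧ Relation.ReflTransGen F z u} = Set.Icc v u := by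
  have hc := h.climbs u v huv hp
  ext z
  constructor
  · rintro ⟨huz, -⟩
    induction huz with
    | refl => exact ⟨hc.1, le_rfl⟩
    | tail _ hbz ih =>
      rcases ih.2.eq_or_lt with rfl | hlt
      · rw [h.out_unique _ _ _ hbz huv]
        exact ⟨le_rfl, hc.1⟩
      · rw [h.out_unique _ _ _ hbz (hc.2 _ ih.1 hlt)]
        exact ⟨ih.1.trans (Nat.le_succ _), hlt⟩
  · rintro ⟨hvz, hzu⟩
    have hvz' : Climbs F v z := ⟨hvz, fun y hy hyz => hc.2 y hy (hyz.trans_le hzu)⟩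
    have hzu' : Climbs F z u := ⟨hzu, fun y hy hyu => hc.2 y (hvz.trans hy) hyu⟩
    exact ⟨.head huv hvz'.reflTransGen, hzu'.reflTransGen⟩

end CyclicFlow

end Flow

section Bound

theorem six_mul_pow_three_le_two_pow {s : ℕ} (hs : 1 ≤ s) : 6 * s ^ 3 ≤ 2 ^ (3 * s) := by
  obtain ⟨r, rfl⟩ := Nat.exists_eq_add_of_le' hs
  calc 6 * (r + 1) ^ 3 ≤ 2 ^ 3 * (2 ^ r) ^ 3 :=
        Nat.mul_le_mul (by norm_num) (Nat.pow_le_pow_left Nat.lt_two_pow_self 3)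
    _ = 2 ^ (3 * (r + 1)) := by ring

theorem pow_le_two_pow_three_mul_pow {n : ℕ} (hn : 1 ≤ n) (p : ℕ) :
    (6 * (4 * (n + 1)) ^ p) ^ p ≤ 2 ^ (3 * (2 * n) ^ (2 * p)) := by
  set s := (2 * n) ^ p with hs
  have hcube : (4 * (n + 1)) ^ p ≤ s ^ 3 := by
    rw [hs, pow_right_comm]
    refine Nat.pow_le_pow_left ?_ p
    calc 4 * (n + 1) ≤ 8 * n := by omega
      _ ≤ 8 * n ^ 3 := Nat.mul_le_mul_left 8 (Nat.le_self_pow three_ne_zero n)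
      _ = (2 * n) ^ 3 := by ring
  have hps : p ≤ s := Nat.lt_two_pow_self.le.trans (Nat.pow_le_pow_left (by omega) p)
  calc (6 * (4 * (n + 1)) ^ p) ^ p ≤ (6 * s ^ 3) ^ p := by gcongr
    _ ≤ (2 ^ (3 * s)) ^ p := by
      gcongr
      exact six_mul_pow_three_le_two_pow (Nat.one_le_pow _ _ (by omega))
    _ = 2 ^ (3 * (s * p)) := by rw [← pow_mul, mul_assoc]
    _ ≤ 2 ^ (3 * (s * s)) := by gcongr; norm_num
    _ = 2 ^ (3 * (2 * n) ^ (2 * p)) := by rw [hs]; ring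

end Bound

namespace Run

variable {Q α β : Type*} {T : TwoWayTransducer Q α β} {w : List α}

section Location

variable (ρ : Run T w) {i j : ℕ}

theorem pos_head_succ (hi : i < ρ.len) :
    ρ.pos (i + 1) = (ρ.conf i).head + 1 ∧ (ρ.conf (i + 1)).head = (ρ.conf i).head + 1 ∨
      ρ.pos (i + 1) = (ρ.conf i).head ∧ (ρ.conf i).head = (ρ.conf (i + 1)).head + 1 := by
  have hstep := (ρ.step i hi).2.2.2.2
  cases hdir : (ρ.rule i).dir <;> simp only [hdir] at hstep
  · exact .inr ⟨by simp only [pos, hdir], hstep⟩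
  · exact .inl ⟨by simp only [pos, hdir], hstep⟩

theorem head_lt_length (hi : i < ρ.len) : (ρ.conf i).head < (tape w).length :=
  (List.getElem?_eq_some_iff.1 (ρ.step i hi).2.2.2.1).1

/-- The number of visits to the position `x` before time `n`. -/
def visits (x n : ℕ) : ℕ := ((Finset.range n).filter fun i => ρ.pos i = x).card

theorem level_eq_visits (i : ℕ) : ρ.level i = ρ.visits (ρ.pos i) i := rfl

theorem visits_zero (x : ℕ) : ρ.visits x 0 = 0 := rfl

theorem visits_succ (x n : ℕ) :
    ρ.visits x (n + 1) = ρ.visits x n + if ρ.pos n = x then 1 else 0 := by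
  unfold visits
  rw [Finset.range_add_one, Finset.filter_insert]
  split_ifs
  · exact Finset.card_insert_of_notMem (by simp)
  · rfl

theorem visits_mono (x : ℕ) : Monotone (ρ.visits x) :=
  monotone_nat_of_le_succ fun n => (ρ.visits_succ x n).symm ▸ Nat.le_add_right _ _

theorem length_crossing (x : ℕ) : (ρ.crossing x).length = ρ.visits x (ρ.len + 1) :=
  List.length_map _

theorem level_lt_length_crossing (hi : i ≤ ρ.len) :
    ρ.level i < (ρ.crossing (ρ.pos i)).length := by
  have := ρ.visits_mono (ρ.pos i) (Nat.succ_le_succ hi)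
  rw [visits_succ, if_pos rfl] at this
  rwa [length_crossing, level_eq_visits, ← Nat.succ_le_iff]

theorem exists_visit {x y n : ℕ} (hy : y < ρ.visits x n) :
    ∃ i < n, ρ.pos i = x ∧ ρ.level i = y := by
  induction n with
  | zero => exact absurd hy (Nat.not_lt_zero y)
  | succ n ih =>
    rw [visits_succ] at hy
    by_cases h : y < ρ.visits x n
    · obtain ⟨i, hi, hloc⟩ := ih h
      exact ⟨i, hi.trans n.lt_succ_self, hloc⟩
    · split_ifs at hy with hx
      · exact ⟨n, n.lt_succ_self, hx, by rw [level_eq_visits, hx]; omega⟩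
      · exact absurd hy h

theorem exists_loc_of_lt_length_crossing {x y : ℕ} (hy : y < (ρ.crossing x).length) :
    ∃ i ≤ ρ.len, ρ.pos i = x ∧ ρ.level i = y := by
  obtain ⟨i, hi, hloc⟩ := ρ.exists_visit (ρ.length_crossing x ▸ hy)
  exact ⟨i, Nat.lt_succ_iff.1 hi, hloc⟩

theorem level_lt_level (hij : i < j) (h : ρ.pos i = ρ.pos j) : ρ.level i < ρ.level j := by
  have := ρ.visits_mono (ρ.pos j) (Nat.succ_le_iff.2 hij)
  rw [visits_succ, if_pos h] at this
  rwa [level_eq_visits, level_eq_visits, h, ← Nat.succ_le_iff]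

theorem level_lt_level_iff (h : ρ.pos i = ρ.pos j) : ρ.level i < ρ.level j ↔ i < j := by
  refine ⟨fun hlt => ?_, fun hij => ρ.level_lt_level hij h⟩
  rcases lt_trichotomy i j with hij | rfl | hij
  · exact hij
  · exact absurd hlt (lt_irrefl _)
  · exact absurd hlt (ρ.level_lt_level hij h.symm).asymm

theorem loc_injective : Function.Injective ρ.loc := by
  intro i j h
  obtain ⟨hpos, hlevel⟩ := Prod.ext_iff.1 h
  rcases lt_trichotomy i j with hij | rfl | hij
  · exact absurd hlevel (ρ.level_lt_level hij hpos).ne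
  · rfl
  · exact absurd hlevel (ρ.level_lt_level hij hpos.symm).ne'

theorem level_eq_level_succ_of_forall_ne (hij : i < j) (h : ρ.pos i = ρ.pos j)
    (hne : ∀ k, i < k → k < j → ρ.pos k ≠ ρ.pos j) : ρ.level j = ρ.level i + 1 := by
  have visits_eq : ∀ k, i < k → k ≤ j → ρ.visits (ρ.pos j) k = ρ.level i + 1 := by
    intro k hik
    induction k, hik using Nat.le_induction with
    | base => intro _; rw [visits_succ, if_pos h, level_eq_visits, h]
    | succ k hik ih =>
      intro hkj
      rw [visits_succ, ih (by omega), if_neg (hne k hik (by omega))]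
  exact visits_eq j hij le_rfl

end Location

namespace Successful

variable {ρ : Run T w} (hρ : ρ.Successful) {i : ℕ}

include hρ

theorem head_zero : (ρ.conf 0).head = 0 := congrArg Config.head hρ.1

theorem pos_zero : ρ.pos 0 = 0 := hρ.head_zero

theorem head_len : (ρ.conf ρ.len).head = (tape w).length := by
  obtain ⟨q, -, hq⟩ := hρ.2
  exact congrArg Config.head hq

-- Every visit to `x` takes the head from one side of the cut `x` to the other.
theorem odd_visits_iff (x : ℕ) (hi : i ≤ ρ.len) :
    Odd (ρ.visits x (i + 1)) ↔ x ≤ (ρ.conf i).head := by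
  induction i with
  | zero =>
    rw [visits_succ, visits_zero, hρ.pos_zero, hρ.head_zero]
    split_ifs with hx <;> simp <;> omega
  | succ i ih =>
    have ih := ih (by omega)
    have := ρ.pos_head_succ hi
    rw [visits_succ]
    split_ifs with hx
    · rw [Nat.odd_add_one, ih]; omega
    · rw [add_zero, ih]; omega

theorem pos_eq_ite (hi : i ≤ ρ.len) :
    ρ.pos i = if Even (ρ.level i) then (ρ.conf i).head else (ρ.conf i).head + 1 := by
  have hlevel : Even (ρ.level i) ↔ ρ.pos i ≤ (ρ.conf i).head := by
    rw [← hρ.odd_visits_iff _ hi, visits_succ, if_pos rfl, Nat.odd_add_one, Nat.not_odd_iff_even]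
    rfl
  have hnear : ρ.pos i = (ρ.conf i).head ∨ ρ.pos i = (ρ.conf i).head + 1 := by
    cases i with
    | zero => exact .inl rfl
    | succ i => have := ρ.pos_head_succ hi; omega
  simp only [hlevel]
  split_ifs <;> omega

theorem odd_length_crossing {x : ℕ} (hx : x ≤ (tape w).length) : Odd (ρ.crossing x).length := by
  rw [length_crossing, hρ.odd_visits_iff x le_rfl, hρ.head_len]
  exact hx

end Successful

section Intercepted

variable {ρ : Run T w} {x y i j i' j' : ℕ}

namespace Intercepted

theorem start_le_and_finish_le {x' y' t : ℕ} (h : ρ.Intercepted x y i j)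
    (h' : ρ.Intercepted x' y' i' j') (hx : x ≤ x') (hy : y' ≤ y) (ht : t ∈ Set.Ico i j)
    (ht' : t ∈ Set.Ico i' j') : i ≤ i' ∧ j' ≤ j := by
  obtain ⟨-, -, -, hi, hj⟩ := h
  obtain ⟨-, hj', hin', -, -⟩ := h'
  have hin (k : ℕ) (hk : k ∈ Set.Ico i' j') : ρ.Inside x y k :=
    ⟨hx.trans (hin' k hk.1 hk.2).1, (hin' k hk.1 hk.2).2.trans_le hy⟩
  rw [Set.mem_Ico] at ht ht'
  constructor
  · by_contra hlt
    exact hi (by omega) (hin _ ⟨by omega, by omega⟩)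
  · by_contra hlt
    exact hj (by omega) (hin _ ⟨by omega, by omega⟩)

theorem eq_or_lt (h : ρ.Intercepted x y i j) (h' : ρ.Intercepted x y i' j') :
    (i = i' ∧ j = j') ∨ j < i' ∨ j' < i := by
  by_cases hmeet : ∃ t, t ∈ Set.Ico i j ∧ t ∈ Set.Ico i' j'
  · obtain ⟨t, ht, ht'⟩ := hmeet
    have hle := h.start_le_and_finish_le h' le_rfl le_rfl ht ht'
    have hge := h'.start_le_and_finish_le h le_rfl le_rfl ht' ht
    omega
  · have hdisjoint : ¬max i i' < min j j' := fun hlt =>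
      hmeet ⟨max i i', ⟨by omega, by omega⟩, by omega, by omega⟩
    obtain ⟨hij, hj, hin, -, hout⟩ := h
    obtain ⟨hij', hj', hin', -, hout'⟩ := h'
    have hne : j ≠ i' := fun e => hout (by omega) (hin' j (by omega) (by omega))
    have hne' : j' ≠ i := fun e => hout' (by omega) (hin j' (by omega) (by omega))
    omega

theorem pos_mem_Ioo {k : ℕ} (h : ρ.Intercepted x y i j) (hik : i < k) (hkj : k < j) :
    ρ.pos k ∈ Set.Ioo x y := by
  obtain ⟨-, hj, hin, -, -⟩ := h
  obtain ⟨k, rfl⟩ : ∃ l, k = l + 1 := ⟨k - 1, by omega⟩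
  have hstep := ρ.pos_head_succ (i := k) (by omega)
  obtain ⟨h₁, h₂⟩ := hin k (by omega) (by omega)
  obtain ⟨h₃, h₄⟩ := hin (k + 1) (by omega) hkj
  rw [Set.mem_Ioo]
  omega

end Intercepted

theorem Successful.exists_intercepted (hρ : ρ.Successful) (hI : ρ.IsInterval x y) {t : ℕ}
    (ht : t < ρ.len) (hin : ρ.Inside x y t) : ∃ i j, ρ.Intercepted x y i j ∧ i ≤ t ∧ t < j := by
  classical
  have hlen : ¬ρ.Inside x y ρ.len := fun h => (hρ.head_len ▸ h.2).not_ge hI.2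
  have hfinish : ∃ j, t < j ∧ ¬ρ.Inside x y j := ⟨ρ.len, ht, hlen⟩
  have hstart : ∃ i ≤ t, ∀ k, i ≤ k → k ≤ t → ρ.Inside x y k :=
    ⟨t, le_rfl, fun k h₁ h₂ => le_antisymm h₁ h₂ ▸ hin⟩
  obtain ⟨htj, hj⟩ := Nat.find_spec hfinish
  obtain ⟨hit, hi⟩ := Nat.find_spec hstart
  refine ⟨Nat.find hstart, Nat.find hfinish, ⟨hit.trans_lt htj,
    Nat.find_min' hfinish ⟨ht, hlen⟩, fun k hik hkj => ?_, fun hpos hprev => ?_, fun _ => hj⟩,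
    hit, htj⟩
  · by_cases hkt : k ≤ t
    · exact hi k hik hkt
    · by_contra hk
      exact Nat.find_min hfinish hkj ⟨by omega, hk⟩
  · refine Nat.find_min hstart (Nat.sub_lt hpos one_pos) ⟨by omega, fun k hk hkt => ?_⟩
    rcases hk.eq_or_lt with rfl | hk
    · exact hprev
    · exact hi k (by omega) hkt

namespace Successful

variable (hρ : ρ.Successful)

include hρ

theorem pos_start (hij : ρ.Intercepted x y i j) :
    ρ.pos i = if Even (ρ.level i) then x else y := by
  obtain ⟨hlt, hj, hin, hprev, -⟩ := hij
  have hi := hin i le_rfl hlt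
  have hpos := hρ.pos_eq_ite (i := i) (by omega)
  cases i with
  | zero =>
    have h₀ : ρ.level 0 = 0 := rfl
    have := hρ.head_zero
    simp only [Inside, h₀, Even.zero, if_true] at hi hpos ⊢
    omega
  | succ i =>
    have := ρ.pos_head_succ (i := i) (by omega)
    have hprev := hprev i.succ_pos
    simp only [Inside, Nat.add_sub_cancel] at hi hprev
    split_ifs at hpos ⊢ <;> omega

theorem pos_finish (hI : ρ.IsInterval x y) (hij : ρ.Intercepted x y i j) :
    ρ.pos j = if Even (ρ.level j) then y else x := by
  obtain ⟨hlt, hj, hin, -, hout⟩ := hij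
  obtain ⟨j, rfl⟩ : ∃ l, j = l + 1 := ⟨j - 1, by omega⟩
  have hpos := hρ.pos_eq_ite hj
  have hlast := hin j (by omega) (by omega)
  have hstep := ρ.pos_head_succ (i := j) (by omega)
  have hout : ¬ρ.Inside x y (j + 1) := by
    rcases hj.eq_or_lt with hj | hj
    · exact fun h => (hρ.head_len ▸ hj ▸ h.2).not_ge hI.2
    · exact hout hj
  simp only [Inside] at hlast hout
  split_ifs at hpos ⊢ <;> omega

theorem exists_intercepted_start (hI : ρ.IsInterval x y) (hi : i ≤ ρ.len)
    (hpos : ρ.pos i = if Even (ρ.level i) then x else y) : ∃ j, ρ.Intercepted x y i j := by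
  obtain ⟨hxy, hy⟩ := hI
  have hhead := hρ.pos_eq_ite hi
  have hin : ρ.Inside x y i := by
    cases i with
    | zero =>
      have h₀ : ρ.level 0 = 0 := rfl
      simp only [h₀, Even.zero, if_true] at hpos hhead
      exact ⟨by omega, by omega⟩
    | succ i =>
      have := ρ.pos_head_succ (i := i) (by omega)
      simp only [Inside]
      split_ifs at hpos hhead <;> omega
  have hlen : i ≠ ρ.len := by
    rintro rfl
    have := hρ.head_len ▸ hin.2
    omega
  obtain ⟨i', j, hij, hle, hlt⟩ := hρ.exists_intercepted ⟨hxy, hy⟩ (by omega) hin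
  rcases hle.eq_or_lt with rfl | hi'
  · exact ⟨j, hij⟩
  · have := hij.pos_mem_Ioo hi' hlt
    rw [Set.mem_Ioo, hpos] at this
    split_ifs at this <;> omega

theorem exists_intercepted_finish (hI : ρ.IsInterval x y) (hj : j ≤ ρ.len)
    (hpos : ρ.pos j = if Even (ρ.level j) then y else x) : ∃ i, ρ.Intercepted x y i j := by
  have hhead := hρ.pos_eq_ite hj
  have hxy := hI.1
  cases j with
  | zero =>
    have h₀ : ρ.level 0 = 0 := rfl
    have := hρ.pos_zero
    simp only [h₀, Even.zero, if_true] at hpos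
    omega
  | succ j =>
    have hstep := ρ.pos_head_succ (i := j) (by omega)
    have hin : ρ.Inside x y j := by
      simp only [Inside]
      split_ifs at hpos hhead <;> omega
    obtain ⟨i, j', hij, hle, hlt⟩ := hρ.exists_intercepted hI (by omega) hin
    rcases (Nat.succ_le_iff.2 hlt).eq_or_lt with rfl | hj'
    · exact ⟨i, hij⟩
    · have := hij.pos_mem_Ioo (Nat.lt_succ_iff.2 hle) hj'
      rw [Set.mem_Ioo, hpos] at this
      split_ifs at this <;> omega

end Successful

end Intercepted

section Flow

variable {ρ : Run T w} {x y i j i' j' u v : ℕ}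

theorem Intercepted.edgeFactor (hij : ρ.Intercepted x y i j) (hρ : ρ.Successful)
    (hI : ρ.IsInterval x y) : ρ.EdgeFactor x y (ρ.level i) (ρ.level j) i j := by
  have hi := hρ.pos_start hij
  have hj := hρ.pos_finish hI hij
  refine ⟨hij, ?_, ?_⟩
  · split_ifs at hi <;> simp [loc, hi]
  · split_ifs at hj <;> simp [loc, hj]

namespace Successful

variable (hρ : ρ.Successful)

include hρ

theorem flow_iff (hI : ρ.IsInterval x y) :
    ρ.flow x y u v ↔ ∃ i j, ρ.Intercepted x y i j ∧ ρ.level i = u ∧ ρ.level j = v := by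
  constructor
  · rintro ⟨i, j, hij, hi, hj⟩
    exact ⟨i, j, hij, hi.elim (congrArg Prod.snd) (congrArg Prod.snd),
      hj.elim (congrArg Prod.snd) (congrArg Prod.snd)⟩
  · rintro ⟨i, j, hij, rfl, rfl⟩
    exact ⟨i, j, hij.edgeFactor hρ hI⟩

theorem start_unique (hij : ρ.Intercepted x y i j) (hij' : ρ.Intercepted x y i' j')
    (h : ρ.level i = ρ.level i') : i = i' ∧ j = j' := by
  have hpos := hρ.pos_start hij
  rw [h, ← hρ.pos_start hij'] at hpos
  have hi : i = i' := ρ.loc_injective (Prod.ext hpos h)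
  rcases hij.eq_or_lt hij' with h | h | h
  · exact h
  · have := hij.1; omega
  · have := hij'.1; omega

theorem finish_unique (hI : ρ.IsInterval x y) (hij : ρ.Intercepted x y i j)
    (hij' : ρ.Intercepted x y i' j') (h : ρ.level j = ρ.level j') : i = i' ∧ j = j' := by
  have hpos := hρ.pos_finish hI hij
  rw [h, ← hρ.pos_finish hI hij'] at hpos
  have hj : j = j' := ρ.loc_injective (Prod.ext hpos h)
  rcases hij.eq_or_lt hij' with h | h | h
  · exact h
  · have := hij'.1; omega
  · have := hij.1; omega

theorem flow_out_unique (hI : ρ.IsInterval x y) {v' : ℕ} (h : ρ.flow x y u v)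
    (h' : ρ.flow x y u v') : v = v' := by
  obtain ⟨i, j, hij, rfl, rfl⟩ := (hρ.flow_iff hI).1 h
  obtain ⟨i', j', hij', hi', rfl⟩ := (hρ.flow_iff hI).1 h'
  rw [(hρ.start_unique hij hij' hi'.symm).2]

theorem flow_in_unique (hI : ρ.IsInterval x y) {u' : ℕ} (h : ρ.flow x y u v)
    (h' : ρ.flow x y u' v) : u = u' := by
  obtain ⟨i, j, hij, rfl, rfl⟩ := (hρ.flow_iff hI).1 h
  obtain ⟨i', j', hij', rfl, hj'⟩ := (hρ.flow_iff hI).1 h'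
  rw [(hρ.finish_unique hI hij hij' hj'.symm).1]

theorem exists_flow_out_iff (hI : ρ.IsInterval x y) :
    (∃ v, ρ.flow x y u v) ↔ u < (ρ.crossing (if Even u then x else y)).length := by
  constructor
  · rintro ⟨v, huv⟩
    obtain ⟨i, j, hij, rfl, -⟩ := (hρ.flow_iff hI).1 huv
    exact hρ.pos_start hij ▸ ρ.level_lt_length_crossing (hij.1.le.trans hij.2.1)
  · intro hu
    obtain ⟨i, hi, hpos, rfl⟩ := ρ.exists_loc_of_lt_length_crossing hu
    obtain ⟨j, hij⟩ := hρ.exists_intercepted_start hI hi hpos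
    exact ⟨_, (hρ.flow_iff hI).2 ⟨i, j, hij, rfl, rfl⟩⟩

theorem exists_flow_in_iff (hI : ρ.IsInterval x y) :
    (∃ u, ρ.flow x y u v) ↔ v < (ρ.crossing (if Even v then y else x)).length := by
  constructor
  · rintro ⟨u, huv⟩
    obtain ⟨i, j, hij, -, rfl⟩ := (hρ.flow_iff hI).1 huv
    exact hρ.pos_finish hI hij ▸ ρ.level_lt_length_crossing hij.2.1
  · intro hv
    obtain ⟨j, hj, hpos, rfl⟩ := ρ.exists_loc_of_lt_length_crossing hv
    obtain ⟨i, hij⟩ := hρ.exists_intercepted_finish hI hj hpos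
    exact ⟨_, (hρ.flow_iff hI).2 ⟨i, j, hij, rfl, rfl⟩⟩

/- A factor that returns to its border `p` does not visit `p` in between, so its ends are
consecutive visits of `p`. -/
theorem flow_turn (hI : ρ.IsInterval x y) (huv : ρ.flow x y u v) (hp : ¬(Even u ↔ Even v)) :
    v = u + 1 := by
  obtain ⟨i, j, hij, rfl, rfl⟩ := (hρ.flow_iff hI).1 huv
  have hi := hρ.pos_start hij
  have hj := hρ.pos_finish hI hij
  refine ρ.level_eq_level_succ_of_forall_ne hij.1 (by split_ifs at hi hj <;> grind)
    fun k hik hkj hk => ?_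
  have := hij.pos_mem_Ioo hik hkj
  rw [hk, hj, Set.mem_Ioo] at this
  split_ifs at this <;> omega

theorem ascendingFlow (hI : ρ.IsInterval x y) : AscendingFlow (ρ.flow x y) where
  out_unique _ _ _ := hρ.flow_out_unique hI
  turn _ _ := hρ.flow_turn hI

theorem intercepted_of_flow (hI : ρ.IsInterval x y) (h : ρ.flow x y (ρ.level i) (ρ.level j))
    (hi : ρ.pos i = if Even (ρ.level i) then x else y)
    (hj : ρ.pos j = if Even (ρ.level j) then y else x) : ρ.Intercepted x y i j := by
  obtain ⟨i', j', hij, hi', hj'⟩ := (hρ.flow_iff hI).1 h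
  have hpos := hρ.pos_start hij
  have hpos' := hρ.pos_finish hI hij
  rw [hi', ← hi] at hpos
  rw [hj', ← hj] at hpos'
  rwa [← ρ.loc_injective (Prod.ext hpos hi'), ← ρ.loc_injective (Prod.ext hpos' hj')]

end Successful

end Flow

section Split

variable {ρ : Run T w} {a b d i j k k' u v : ℕ}

namespace Successful

variable (hρ : ρ.Successful)

include hρ

theorem exists_intercepted_initial {x y x' y' : ℕ} (hij : ρ.Intercepted x y i j)
    (hI : ρ.IsInterval x' y') (hx : x ≤ x') (hy : y' ≤ y)
    (hi : ρ.pos i = if Even (ρ.level i) then x' else y') (hj : ρ.pos j ≠ x' ∧ ρ.pos j ≠ y') :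
    ∃ p < j, ρ.Intercepted x' y' i p ∧ ρ.pos p ∈ Set.Ioo x y := by
  obtain ⟨p, hip⟩ := hρ.exists_intercepted_start hI (hij.1.le.trans hij.2.1) hi
  have hle := (hij.start_le_and_finish_le hip hx hy (t := i) ⟨le_rfl, hij.1⟩ ⟨le_rfl, hip.1⟩).2
  have hne : p ≠ j := by
    rintro rfl
    have := hρ.pos_finish hI hip
    split_ifs at this
    exacts [hj.2 this, hj.1 this]
  have hlt := lt_of_le_of_ne hle hne
  exact ⟨p, hlt, hip, hij.pos_mem_Ioo hip.1 hlt⟩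

theorem exists_intercepted_final {x y x' y' : ℕ} (hij : ρ.Intercepted x y i j)
    (hI : ρ.IsInterval x' y') (hx : x ≤ x') (hy : y' ≤ y)
    (hj : ρ.pos j = if Even (ρ.level j) then y' else x') (hi : ρ.pos i ≠ x' ∧ ρ.pos i ≠ y') :
    ∃ q > i, ρ.Intercepted x' y' q j ∧ ρ.pos q ∈ Set.Ioo x y := by
  obtain ⟨q, hqj⟩ := hρ.exists_intercepted_finish hI hij.2.1 hj
  have hle := (hij.start_le_and_finish_le hqj hx hy (t := j - 1)
    (Set.mem_Ico.2 (by have := hij.1; omega)) (Set.mem_Ico.2 (by have := hqj.1; omega))).1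
  have hne : i ≠ q := by
    rintro rfl
    have := hρ.pos_start hqj
    split_ifs at this
    exacts [hi.1 this, hi.2 this]
  have hlt := lt_of_le_of_ne hle hne
  exact ⟨q, hlt, hqj, hij.pos_mem_Ioo hlt hqj.1⟩

variable (hab : ρ.IsInterval a b) (hbd : ρ.IsInterval b d)

include hab hbd

theorem flow_level_succ (hkk' : k < k') (hk' : k' ≤ ρ.len) (hpos : ρ.pos k = b)
    (hpos' : ρ.pos k' = b) (hin : ∀ t, k ≤ t → t < k' → ρ.Inside a d t) :
    ρ.flow a b (ρ.level k) (ρ.level k + 1) ∨ ρ.flow b d (ρ.level k) (ρ.level k + 1) := by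
  have hltab := hab.1
  have hltbd := hbd.1
  by_cases hk : Even (ρ.level k)
  · obtain ⟨j, hkj⟩ := hρ.exists_intercepted_start (i := k) hbd (by omega) (by rwa [if_pos hk])
    have hflow := (hρ.flow_iff hbd).2 ⟨k, j, hkj, rfl, rfl⟩
    have hj : ¬Even (ρ.level j) := fun hj => by
      have hposj := hρ.pos_finish hbd hkj
      have hhead := hρ.pos_eq_ite hkj.2.1
      rw [if_pos hj] at hposj hhead
      rcases lt_trichotomy j k' with hlt | rfl | hlt
      · have := (hin j hkj.1.le hlt).2; omega
      · omega
      · exact (hkj.pos_mem_Ioo hkk' hlt).1.ne' hpos'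
    exact .inr (hρ.flow_turn hbd hflow (by tauto) ▸ hflow)
  · obtain ⟨j, hkj⟩ := hρ.exists_intercepted_start (i := k) hab (by omega) (by rwa [if_neg hk])
    have hflow := (hρ.flow_iff hab).2 ⟨k, j, hkj, rfl, rfl⟩
    have hj : Even (ρ.level j) := by
      by_contra hj
      have hposj := hρ.pos_finish hab hkj
      have hhead := hρ.pos_eq_ite hkj.2.1
      rw [if_neg hj] at hposj hhead
      rcases lt_trichotomy j k' with hlt | rfl | hlt
      · have := (hin j hkj.1.le hlt).1; omega
      · omega
      · exact (hkj.pos_mem_Ioo hkk' hlt).2.ne hpos'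
    exact .inl (hρ.flow_turn hab hflow (by tauto) ▸ hflow)

theorem climbs_sup_flow (hkk' : k ≤ k') (hk' : k' ≤ ρ.len) (hpos : ρ.pos k = b)
    (hpos' : ρ.pos k' = b) (hin : ∀ t, k ≤ t → t < k' → ρ.Inside a d t) :
    Climbs (ρ.flow a b ⊔ ρ.flow b d) (ρ.level k) (ρ.level k') := by
  have hpp' := hpos.trans hpos'.symm
  refine ⟨not_lt.1 fun h => hkk'.not_gt ((ρ.level_lt_level_iff hpp'.symm).1 h), ?_⟩
  intro n hkn hnk'
  obtain ⟨l, -, hposl, rfl⟩ := ρ.exists_loc_of_lt_length_crossing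
    (hnk'.trans (hpos' ▸ ρ.level_lt_length_crossing hk'))
  have hkl : k ≤ l := not_lt.1 fun h =>
    hkn.not_gt ((ρ.level_lt_level_iff (hposl.trans hpos.symm)).2 h)
  have hlk' : l < k' := (ρ.level_lt_level_iff (hposl.trans hpos'.symm)).1 hnk'
  exact hρ.flow_level_succ hab hbd hlk' hk' hposl hpos' fun t ht => hin t (hkl.trans ht)

theorem exists_flow_of_flow_even (h : ρ.flow a d u v) (hu : Even u) (hv : Even v) :
    ∃ m n, Even m ∧ Even n ∧ ρ.flow a b u m ∧ ρ.flow b d n v ∧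
      Climbs (ρ.flow a b ⊔ ρ.flow b d) m n := by
  have hltab := hab.1
  have hltbd := hbd.1
  have had : ρ.IsInterval a d := ⟨hltab.trans hltbd, hbd.2⟩
  obtain ⟨i, j, hij, rfl, rfl⟩ := (hρ.flow_iff had).1 h
  have hi : ρ.pos i = a := by rw [hρ.pos_start hij, if_pos hu]
  have hj : ρ.pos j = d := by rw [hρ.pos_finish had hij, if_pos hv]
  obtain ⟨p, -, hip, hp⟩ := hρ.exists_intercepted_initial hij hab le_rfl hltbd.le
    (by rwa [if_pos hu]) (by omega)
  obtain ⟨q, hiq, hqj, hq⟩ := hρ.exists_intercepted_final hij hbd hltab.le le_rfl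
    (by rwa [if_pos hv]) (by omega)
  have hp_even : Even (ρ.level p) := by
    by_contra hodd
    exact hp.1.ne' (by rw [hρ.pos_finish hab hip, if_neg hodd])
  have hq_even : Even (ρ.level q) := by
    by_contra hodd
    exact hq.2.ne (by rw [hρ.pos_start hqj, if_neg hodd])
  have hpq : p ≤ q := not_lt.1 fun hlt =>
    (hip.2.2.1 q hiq.le hlt).2.not_ge (hqj.2.2.1 q le_rfl hqj.1).1
  refine ⟨_, _, hp_even, hq_even, (hρ.flow_iff hab).2 ⟨i, p, hip, rfl, rfl⟩,
    (hρ.flow_iff hbd).2 ⟨q, j, hqj, rfl, rfl⟩,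
    hρ.climbs_sup_flow hab hbd hpq (hqj.1.le.trans hqj.2.1)
      (by rw [hρ.pos_finish hab hip, if_pos hp_even])
      (by rw [hρ.pos_start hqj, if_pos hq_even]) fun t hpt htq => ?_⟩
  exact hij.2.2.1 t (hip.1.le.trans hpt) (htq.trans hqj.1)

theorem exists_flow_of_flow_odd (h : ρ.flow a d u v) (hu : ¬Even u) (hv : ¬Even v) :
    ∃ m n, ¬Even m ∧ ¬Even n ∧ ρ.flow b d u m ∧ ρ.flow a b n v ∧
      Climbs (ρ.flow a b ⊔ ρ.flow b d) m n := by
  have hltab := hab.1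
  have hltbd := hbd.1
  have had : ρ.IsInterval a d := ⟨hltab.trans hltbd, hbd.2⟩
  obtain ⟨i, j, hij, rfl, rfl⟩ := (hρ.flow_iff had).1 h
  have hi : ρ.pos i = d := by rw [hρ.pos_start hij, if_neg hu]
  have hj : ρ.pos j = a := by rw [hρ.pos_finish had hij, if_neg hv]
  obtain ⟨p, -, hip, hp⟩ := hρ.exists_intercepted_initial hij hbd hltab.le le_rfl
    (by rwa [if_neg hu]) (by omega)
  obtain ⟨q, hiq, hqj, hq⟩ := hρ.exists_intercepted_final hij hab le_rfl hltbd.le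
    (by rwa [if_neg hv]) (by omega)
  have hp_odd : ¬Even (ρ.level p) := fun heven =>
    hp.2.ne (by rw [hρ.pos_finish hbd hip, if_pos heven])
  have hq_odd : ¬Even (ρ.level q) := fun heven =>
    hq.1.ne' (by rw [hρ.pos_start hqj, if_pos heven])
  have hpq : p ≤ q := not_lt.1 fun hlt =>
    (hqj.2.2.1 q le_rfl hqj.1).2.not_ge (hip.2.2.1 q hiq.le hlt).1
  refine ⟨_, _, hp_odd, hq_odd, (hρ.flow_iff hbd).2 ⟨i, p, hip, rfl, rfl⟩,
    (hρ.flow_iff hab).2 ⟨q, j, hqj, rfl, rfl⟩,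
    hρ.climbs_sup_flow hab hbd hpq (hqj.1.le.trans hqj.2.1)
      (by rw [hρ.pos_finish hbd hip, if_neg hp_odd])
      (by rw [hρ.pos_start hqj, if_neg hq_odd]) fun t hpt htq => ?_⟩
  exact hij.2.2.1 t (hip.1.le.trans hpt) (htq.trans hqj.1)

theorem cyclicFlow (hab_eq : ρ.flow a b = ρ.flow a d) (hbd_eq : ρ.flow b d = ρ.flow a d) :
    CyclicFlow (ρ.flow a d) where
  toAscendingFlow := hρ.ascendingFlow ⟨hab.1.trans hbd.1, hbd.2⟩
  climbs u v huv hp := by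
    have had : ρ.IsInterval a d := ⟨hab.1.trans hbd.1, hbd.2⟩
    obtain ⟨m, n, hum, hnv, hclimb⟩ : ∃ m n, ρ.flow a d u m ∧ ρ.flow a d n v ∧
        Climbs (ρ.flow a b ⊔ ρ.flow b d) m n := by
      by_cases hu : Even u
      · obtain ⟨m, n, -, -, hum, hnv, hclimb⟩ :=
          hρ.exists_flow_of_flow_even hab hbd huv hu (hp.1 hu)
        exact ⟨m, n, hab_eq ▸ hum, hbd_eq ▸ hnv, hclimb⟩
      · obtain ⟨m, n, -, -, hum, hnv, hclimb⟩ :=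
          hρ.exists_flow_of_flow_odd hab hbd huv hu (hp.not.1 hu)
        exact ⟨m, n, hbd_eq ▸ hum, hab_eq ▸ hnv, hclimb⟩
    obtain rfl := hρ.flow_out_unique had huv hum
    obtain rfl := hρ.flow_in_unique had huv hnv
    rwa [hab_eq, hbd_eq, sup_idem] at hclimb

theorem exists_traverses_of_traverses {l r : ℕ} (h : Traverses (ρ.flow a d) l r) :
    (∃ m, Traverses (ρ.flow a b) l m) ∧ ∃ n, Traverses (ρ.flow b d) n r := by
  rcases h with ⟨hlr, hl, hr⟩ | ⟨hrl, hr, hl⟩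
  · obtain ⟨m, n, hm, hn, hlm, hnr, -⟩ := hρ.exists_flow_of_flow_even hab hbd hlr hl hr
    exact ⟨⟨m, .inl ⟨hlm, hl, hm⟩⟩, n, .inl ⟨hnr, hn, hr⟩⟩
  · obtain ⟨m, n, hm, hn, hrm, hnl, -⟩ := hρ.exists_flow_of_flow_odd hab hbd hrl
      (Nat.not_even_iff_odd.2 hr) (Nat.not_even_iff_odd.2 hl)
    exact ⟨⟨n, .inr ⟨hnl, Nat.not_even_iff_odd.1 hn, hl⟩⟩,
      m, .inr ⟨hrm, hr, Nat.not_even_iff_odd.1 hm⟩⟩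

theorem leftLevels_subset : leftLevels (ρ.flow a d) ⊆ leftLevels (ρ.flow a b) :=
  fun _ ⟨_, h⟩ => (hρ.exists_traverses_of_traverses hab hbd h).1

theorem rightLevels_subset : rightLevels (ρ.flow a d) ⊆ rightLevels (ρ.flow b d) :=
  fun _ ⟨_, h⟩ => (hρ.exists_traverses_of_traverses hab hbd h).2

end Successful

end Split

section Normalized

variable [Fintype Q] {ρ : Run T w} {x y : ℕ} (hn : ρ.Normalized) (hρ : ρ.Successful)

namespace Normalized

include hn hρ

theorem length_crossing_le (hx : x ≤ (tape w).length) : (ρ.crossing x).length ≤ hmax Q := by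
  classical
  have hle : (ρ.crossing x).length ≤ 2 * Fintype.card Q := by
    rw [length_crossing, visits, mul_comm, ← Fintype.card_bool, ← Fintype.card_prod]
    refine Finset.card_le_card_of_injOn
      (fun i => ((ρ.conf i).state, decide (Even (ρ.level i)))) (by simp) fun i hi j hj h => ?_
    simp only [Finset.coe_filter, Finset.mem_range, Set.mem_ofPred_eq] at hi hj
    simp only [Prod.mk.injEq, decide_eq_decide] at h
    exact hn i (by omega) j (by omega) (hi.2.trans hj.2.symm) h.1 h.2
  obtain ⟨k, hk⟩ := hρ.odd_length_crossing hx
  unfold hmax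
  omega

/- The parity of the level of a location that reads the cell `c` determines its position, so the
level alone determines the location. -/
theorem card_reading_le (c : ℕ) :
    ((Finset.range ρ.len).filter fun i => (ρ.conf i).head = c).card ≤ hmax Q := by
  refine (Finset.card_le_card_of_injOn (t := Finset.range (hmax Q)) ρ.level (fun i hi => ?_)
    fun i hi j hj h => ?_).trans (Finset.card_range _).le
  · rw [Finset.mem_coe, Finset.mem_filter, Finset.mem_range] at hi
    have hhead := ρ.head_lt_length hi.1
    have hpos := hρ.pos_eq_ite hi.1.le
    exact Finset.mem_coe.2 (Finset.mem_range.2 ((ρ.level_lt_length_crossing hi.1.le).trans_le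
      (hn.length_crossing_le hρ (by split_ifs at hpos <;> omega))))
  · simp only [Finset.coe_filter, Finset.mem_range, Set.mem_ofPred_eq] at hi hj
    refine ρ.loc_injective (Prod.ext ?_ h)
    rw [loc, loc, hρ.pos_eq_ite hi.1.le, hρ.pos_eq_ite hj.1.le, hi.2, hj.2, h]

theorem isValid_effect (hI : ρ.IsInterval x y) : (ρ.effect x y).IsValid where
  left_le := hn.length_crossing_le hρ (hI.1.le.trans hI.2)
  right_le := hn.length_crossing_le hρ hI.2
  out_unique _ _ _ := hρ.flow_out_unique hI
  in_unique _ _ _ := hρ.flow_in_unique hI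
  even_out _ hu := (hρ.exists_flow_out_iff hI).trans (by rw [if_pos hu]; rfl)
  odd_in _ hv :=
    (hρ.exists_flow_in_iff hI).trans (by rw [if_neg (Nat.not_even_iff_odd.2 hv)]; rfl)
  even_in _ hv := (hρ.exists_flow_in_iff hI).trans (by rw [if_pos hv]; rfl)
  odd_out _ hu :=
    (hρ.exists_flow_out_iff hI).trans (by rw [if_neg (Nat.not_even_iff_odd.2 hu)]; rfl)

theorem isIdempotentLoop (hI : ρ.IsInterval x y) (hc : ρ.crossing x = ρ.crossing y)
    (hF : CyclicFlow (ρ.flow x y)) : ρ.IsIdempotentLoop x y := by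
  refine ⟨⟨hI, hc⟩, ?_⟩
  have hmul : (⟨flowComp (ρ.effect x y).flow (ρ.effect x y).flow, (ρ.effect x y).left,
      (ρ.effect x y).right⟩ : Effect Q) = ρ.effect x y := by
    simp only [effect, hF.flowComp_self]
  rw [Effect.mul, hmul, if_pos ⟨hc.symm, hn.isValid_effect hρ hI⟩]

end Normalized

end Normalized

section Component

variable {ρ : Run T w} {a b c d i j t : ℕ}

namespace Intercepted

variable (hij : ρ.Intercepted a d i j) (hρ : ρ.Successful) (hI : ρ.IsInterval a d)
  (hF : CyclicFlow (ρ.flow a d)) (hp : Even (ρ.level i) ↔ Even (ρ.level j))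

include hij hρ hI hF hp

theorem climbs : Climbs (ρ.flow a d) (ρ.level j) (ρ.level i) :=
  hF.climbs _ _ ((hρ.flow_iff hI).2 ⟨i, j, hij, rfl, rfl⟩) hp

theorem isComponent : ρ.IsComponent a d (Set.Icc (ρ.level j) (ρ.level i)) := by
  refine ⟨ρ.level i, ?_, (hF.setOf_mutually_reachable_eq_Icc
    ((hρ.flow_iff hI).2 ⟨i, j, hij, rfl, rfl⟩) hp).symm⟩
  have hlt := ρ.level_lt_length_crossing (hij.1.le.trans hij.2.1)
  rw [hρ.pos_start hij] at hlt
  split_ifs at hlt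
  · exact lt_max_of_lt_left hlt
  · exact lt_max_of_lt_right hlt

theorem anchor_eq_loc : anchor a d (Set.Icc (ρ.level j) (ρ.level i)) = ρ.loc i := by
  have hle := (hij.climbs hρ hI hF hp).1
  unfold anchor loc
  rw [csInf_Icc hle, csSup_Icc hle, hρ.pos_start hij]
  simp only [hp]
  split_ifs <;> rfl

theorem exists_trace (ht : t ∈ Set.Ico i j) (hout : (ρ.rule t).out ≠ []) :
    ∃ τ, ρ.IsTrace a d (Set.Icc (ρ.level j) (ρ.level i)) τ ∧ outputOf τ ≠ [] := by
  have hcl := hij.climbs hρ hI hF hp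
  have hedge : ∀ n, ∃ s e, n < ρ.level i - ρ.level j →
      ρ.EdgeFactor a d (ρ.level j + n) (ρ.level j + n + 1) s e := fun n => by
    by_cases hn : n < ρ.level i - ρ.level j
    · obtain ⟨s, e, hse⟩ := hcl.2 (ρ.level j + n) (by omega) (by omega)
      exact ⟨s, e, fun _ => hse⟩
    · exact ⟨0, 0, fun h => absurd h hn⟩
  choose s e hse using hedge
  refine ⟨_, ⟨ρ.level i - ρ.level j, fun | 0 => ρ.level i | n + 1 => ρ.level j + n,
    fun | 0 => i | n + 1 => s n, fun | 0 => j | n + 1 => e n, (csSup_Icc hcl.1).symm,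
    (Nat.add_sub_cancel' hcl.1).trans (csSup_Icc hcl.1).symm, ⟨?_, ?_, ?_⟩, ?_, rfl⟩, ?_⟩
  · rintro (_ | n) hn
    · exact ⟨hcl.1, le_rfl⟩
    · rw [Set.mem_Iic] at hn
      exact ⟨Nat.le_add_right _ _, by dsimp only; omega⟩
  · rintro (_ | n) hn (_ | n') hn' h <;> simp only [Set.mem_Iic] at hn hn' h <;> omega
  · rintro z ⟨hjz, hzi⟩
    rcases hzi.eq_or_lt with rfl | hzi
    · exact ⟨0, Nat.zero_le _, rfl⟩
    · exact ⟨z - ρ.level j + 1, Set.mem_Iic.2 (by omega), Nat.add_sub_cancel' hjz⟩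
  · rintro (_ | n) hn
    · exact hij.edgeFactor hρ hI
    · exact hse n (by omega)
  · simp only [outputOf, ne_eq, List.flatMap_eq_nil_iff, List.mem_flatMap, not_forall]
    exact ⟨ρ.rule t, ⟨0, by simp, List.mem_map_of_mem (List.Ico.mem.2 ht)⟩, hout⟩

end Intercepted

/- If `i, j` turned back to its border, then it would also be intercepted by `[a, b]` or by
`[c, d]`, since these have the same flow. -/
theorem Successful.even_level_iff_of_inside (hρ : ρ.Successful) (hab : ρ.IsInterval a b)
    (hcd : ρ.IsInterval c d) (had : ρ.IsInterval a d) (hab_eq : ρ.flow a b = ρ.flow a d)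
    (hcd_eq : ρ.flow c d = ρ.flow a d) (hij : ρ.Intercepted a d i j) (ht : t ∈ Set.Ico i j)
    (hin : ρ.Inside b c t) : Even (ρ.level i) ↔ Even (ρ.level j) := by
  have hflow := (hρ.flow_iff had).2 ⟨i, j, hij, rfl, rfl⟩
  have hi := hρ.pos_start hij
  have hj := hρ.pos_finish had hij
  by_contra hp
  by_cases hu : Even (ρ.level i)
  · have hv : ¬Even (ρ.level j) := by tauto
    have hij' := hρ.intercepted_of_flow (i := i) (j := j) hab (hab_eq ▸ hflow)
      (by rw [hi, if_pos hu, if_pos hu]) (by rw [hj, if_neg hv, if_neg hv])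
    exact (hij'.2.2.1 t ht.1 ht.2).2.not_ge hin.1
  · have hv : Even (ρ.level j) := by tauto
    have hij' := hρ.intercepted_of_flow (i := i) (j := j) hcd (hcd_eq ▸ hflow)
      (by rw [hi, if_neg hu, if_neg hu]) (by rw [hj, if_pos hv, if_pos hv])
    exact hin.2.not_ge (hij'.2.2.1 t ht.1 ht.2).1

end Component

section Traversals

variable {ρ : Run T w} {x y x' y' l r : ℕ}

namespace Successful

variable (hρ : ρ.Successful) (hI : ρ.IsInterval x y)

include hρ hI

theorem exists_intercepted_of_traverses (h : Traverses (ρ.flow x y) l r) :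
    ∃ i j p q, ρ.Intercepted x y i j ∧ (p = i ∧ q = j ∨ p = j ∧ q = i) ∧
      ρ.loc p = (x, l) ∧ ρ.loc q = (y, r) := by
  rcases h with ⟨hlr, hl, hr⟩ | ⟨hrl, hr, hl⟩
  · obtain ⟨i, j, hij, rfl, rfl⟩ := (hρ.flow_iff hI).1 hlr
    refine ⟨i, j, i, j, hij, .inl ⟨rfl, rfl⟩, Prod.ext ?_ rfl, Prod.ext ?_ rfl⟩
    · exact (hρ.pos_start hij).trans (if_pos hl)
    · exact (hρ.pos_finish hI hij).trans (if_pos hr)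
  · obtain ⟨i, j, hij, rfl, rfl⟩ := (hρ.flow_iff hI).1 hrl
    refine ⟨i, j, j, i, hij, .inr ⟨rfl, rfl⟩, Prod.ext ?_ rfl, Prod.ext ?_ rfl⟩
    · exact (hρ.pos_finish hI hij).trans (if_neg (Nat.not_even_iff_odd.2 hl))
    · exact (hρ.pos_start hij).trans (if_neg (Nat.not_even_iff_odd.2 hr))

theorem strictMonoRel_traverses : StrictMonoRel (Traverses (ρ.flow x y)) := by
  intro l r l' r' h h'
  obtain ⟨i, j, p, q, hij, hpq, hp, hq⟩ := hρ.exists_intercepted_of_traverses hI h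
  obtain ⟨i', j', p', q', hij', hpq', hp', hq'⟩ := hρ.exists_intercepted_of_traverses hI h'
  simp only [loc, Prod.mk.injEq] at hp hq hp' hq'
  rw [← hp.2, ← hp'.2, ← hq.2, ← hq'.2, ρ.level_lt_level_iff (hp.1.trans hp'.1.symm),
    ρ.level_lt_level_iff (hq.1.trans hq'.1.symm)]
  have hxy := hI.1
  have hlt := hij.1
  have hlt' := hij'.1
  rcases hij.eq_or_lt hij' with ⟨rfl, rfl⟩ | hjj' | hjj'
  · grind
  · omega
  · omega

theorem leftLevels_subset_Iio :
    leftLevels (ρ.flow x y) ⊆ Set.Iio (ρ.crossing x).length := by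
  rintro l ⟨r, ⟨hlr, hl, -⟩ | ⟨hrl, -, hl⟩⟩
  · have hlt := (hρ.exists_flow_out_iff hI).1 ⟨r, hlr⟩
    rwa [if_pos hl] at hlt
  · have hlt := (hρ.exists_flow_in_iff hI).1 ⟨r, hrl⟩
    rwa [if_neg (Nat.not_even_iff_odd.2 hl)] at hlt

theorem rightLevels_subset_Iio :
    rightLevels (ρ.flow x y) ⊆ Set.Iio (ρ.crossing y).length := by
  rintro r ⟨l, ⟨hlr, -, hr⟩ | ⟨hrl, hr, -⟩⟩
  · have hlt := (hρ.exists_flow_in_iff hI).1 ⟨l, hlr⟩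
    rwa [if_pos hr] at hlt
  · have hlt := (hρ.exists_flow_out_iff hI).1 ⟨l, hrl⟩
    rwa [if_neg (Nat.not_even_iff_odd.2 hr)] at hlt

theorem ncard_leftLevels_eq_ncard_rightLevels :
    (leftLevels (ρ.flow x y)).ncard = (rightLevels (ρ.flow x y)).ncard :=
  (hρ.strictMonoRel_traverses hI).ncard_domain_eq

/- The factor that starts at the last location at position `x` cannot return to this position. -/
theorem leftLevels_nonempty : (leftLevels (ρ.flow x y)).Nonempty := by
  obtain ⟨k, hk⟩ := hρ.odd_length_crossing (hI.1.le.trans hI.2)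
  have heven : Even (2 * k) := even_two_mul k
  obtain ⟨v, hv⟩ := (hρ.exists_flow_out_iff hI (u := 2 * k)).2 (by rw [if_pos heven]; omega)
  by_cases hp : Even v
  · exact ⟨2 * k, v, .inl ⟨hv, heven, hp⟩⟩
  · have hturn := hρ.flow_turn hI hv (by tauto)
    have hlt := (hρ.exists_flow_in_iff hI).1 ⟨_, hv⟩
    rw [if_neg hp] at hlt
    omega

theorem ncard_leftLevels_pos : 0 < (leftLevels (ρ.flow x y)).ncard :=
  (hρ.leftLevels_nonempty hI).ncard_pos ((Set.finite_Iio _).subset (hρ.leftLevels_subset_Iio hI))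

theorem ncard_leftLevels_le : (leftLevels (ρ.flow x y)).ncard ≤ (ρ.crossing x).length :=
  (Set.ncard_le_ncard (hρ.leftLevels_subset_Iio hI) (Set.finite_Iio _)).trans
    (by rw [← Finset.coe_Iio, Set.ncard_coe_finset, Nat.card_Iio])

theorem flow_eq_of_levels_eq (hI' : ρ.IsInterval x' y')
    (hx : (ρ.crossing x).length = (ρ.crossing x').length)
    (hy : (ρ.crossing y).length = (ρ.crossing y').length)
    (hleft : leftLevels (ρ.flow x y) = leftLevels (ρ.flow x' y'))
    (hright : rightLevels (ρ.flow x y) = rightLevels (ρ.flow x' y')) :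
    ρ.flow x y = ρ.flow x' y' := by
  refine (hρ.ascendingFlow hI).eq_of_traverses (hρ.ascendingFlow hI') (fun u => ?_)
    ((hρ.strictMonoRel_traverses hI).eq_of_domain_eq (hρ.strictMonoRel_traverses hI')
      (Set.ext_iff.1 hleft) (Set.ext_iff.1 hright))
  rw [hρ.exists_flow_out_iff hI, hρ.exists_flow_out_iff hI']
  split_ifs <;> omega

theorem leftLevels_eq_of_ncard_eq (hy : y ≤ y') (hy' : y' ≤ (tape w).length)
    (h : (leftLevels (ρ.flow x y)).ncard = (leftLevels (ρ.flow x y')).ncard) :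
    leftLevels (ρ.flow x y) = leftLevels (ρ.flow x y') := by
  rcases hy.eq_or_lt with rfl | hlt
  · rfl
  · exact (Set.eq_of_subset_of_ncard_le (hρ.leftLevels_subset hI ⟨hlt, hy'⟩) h.le
      ((Set.finite_Iio _).subset (hρ.leftLevels_subset_Iio hI))).symm

theorem rightLevels_eq_of_ncard_eq (hx : x' ≤ x)
    (h : (leftLevels (ρ.flow x y)).ncard = (leftLevels (ρ.flow x' y)).ncard) :
    rightLevels (ρ.flow x y) = rightLevels (ρ.flow x' y) := by
  rcases hx.eq_or_lt with rfl | hlt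
  · rfl
  · have hI' : ρ.IsInterval x' y := ⟨hlt.trans hI.1, hI.2⟩
    rw [hρ.ncard_leftLevels_eq_ncard_rightLevels hI,
      hρ.ncard_leftLevels_eq_ncard_rightLevels hI'] at h
    exact (Set.eq_of_subset_of_ncard_le
      (hρ.rightLevels_subset ⟨hlt, hI.1.le.trans hI.2⟩ hI) h.le
      ((Set.finite_Iio _).subset (hρ.rightLevels_subset_Iio hI))).symm

end Successful

end Traversals

section Uniform

/-- A set of positions with the same crossing sequence, any two of which delimit intervals with the
same flow. -/
structure IsUniform (ρ : Run T w) (U : Finset ℕ) : Prop where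
  le_length : ∀ x ∈ U, x ≤ (tape w).length
  crossing_eq : ∀ x ∈ U, ∀ y ∈ U, ρ.crossing x = ρ.crossing y
  flow_eq : ∀ x ∈ U, ∀ y ∈ U, ∀ x' ∈ U, ∀ y' ∈ U, x < y → x' < y' → ρ.flow x y = ρ.flow x' y'

variable [Fintype Q]

/-- The crossing sequence at `x`, together with the levels at `x` of the traversing edges of
`[lo, x]` and of `[x, up]`. All of this is recorded below `h_max` only, so that there are finitely
many border types; normalized runs have no higher levels. -/
def borderType (ρ : Run T w) (lo up x : ℕ) (k : Fin (hmax Q)) : Option Q × Prop × Prop :=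
  ((ρ.crossing x)[(k : ℕ)]?, ↑k ∈ rightLevels (ρ.flow lo x), ↑k ∈ leftLevels (ρ.flow x up))

variable {ρ : Run T w} {lo up x x' y y' : ℕ}

theorem exists_subset_borderType_eq {S : Finset ℕ} {n : ℕ}
    (hS : n * (4 * (Fintype.card Q + 1)) ^ hmax Q < S.card) (ρ : Run T w) (lo up : ℕ) :
    ∃ U ⊆ S, n < U.card ∧ ∀ x ∈ U, ∀ y ∈ U, ρ.borderType lo up x = ρ.borderType lo up y := by
  classical
  obtain ⟨c, -, hc⟩ := Finset.exists_lt_card_fiber_of_mul_lt_card_of_maps_to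
    (t := Finset.univ) (f := ρ.borderType lo up) (s := S) (fun _ _ => Finset.mem_univ _)
    (n := n) (by
      simp only [Finset.card_univ, Fintype.card_pi_const, Fintype.card_prod, Fintype.card_option,
        Fintype.card_prop]
      convert hS using 1
      ring)
  exact ⟨_, Finset.filter_subset _ _, hc, fun x hx y hy =>
    (Finset.mem_filter.1 hx).2.trans (Finset.mem_filter.1 hy).2.symm⟩

namespace Normalized

variable (hn : ρ.Normalized) (hρ : ρ.Successful)

include hn hρ

theorem crossing_eq_of_borderType_eq (hx : x ≤ (tape w).length) (hx' : x' ≤ (tape w).length)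
    (h : ρ.borderType lo up x = ρ.borderType lo up x') : ρ.crossing x = ρ.crossing x' := by
  refine List.ext_getElem? fun k => ?_
  by_cases hk : k < hmax Q
  · exact congrArg Prod.fst (congrFun h ⟨k, hk⟩)
  · have hle := hn.length_crossing_le hρ hx
    have hle' := hn.length_crossing_le hρ hx'
    rw [List.getElem?_eq_none (by omega), List.getElem?_eq_none (by omega)]

theorem leftLevels_eq_of_borderType_eq (hI : ρ.IsInterval x up) (hI' : ρ.IsInterval x' up)
    (h : ρ.borderType lo up x = ρ.borderType lo up x') :
    leftLevels (ρ.flow x up) = leftLevels (ρ.flow x' up) := by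
  ext k
  by_cases hk : k < hmax Q
  · exact iff_of_eq (congrArg (fun c => c.2.2) (congrFun h ⟨k, hk⟩))
  · have hle := hn.length_crossing_le hρ (hI.1.le.trans hI.2)
    have hle' := hn.length_crossing_le hρ (hI'.1.le.trans hI'.2)
    exact iff_of_false (fun hm => hk ((hρ.leftLevels_subset_Iio hI hm).trans_le hle))
      fun hm => hk ((hρ.leftLevels_subset_Iio hI' hm).trans_le hle')

theorem rightLevels_eq_of_borderType_eq (hI : ρ.IsInterval lo y) (hI' : ρ.IsInterval lo y')
    (h : ρ.borderType lo up y = ρ.borderType lo up y') :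
    rightLevels (ρ.flow lo y) = rightLevels (ρ.flow lo y') := by
  ext k
  by_cases hk : k < hmax Q
  · exact iff_of_eq (congrArg (fun c => c.2.1) (congrFun h ⟨k, hk⟩))
  · have hle := hn.length_crossing_le hρ hI.2
    have hle' := hn.length_crossing_le hρ hI'.2
    exact iff_of_false (fun hm => hk ((hρ.rightLevels_subset_Iio hI hm).trans_le hle))
      fun hm => hk ((hρ.rightLevels_subset_Iio hI' hm).trans_le hle')

theorem exists_subset_ncard_leftLevels_eq {S : Finset ℕ} {n : ℕ} (hS : n ^ hmax Q < S.card)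
    (hlen : ∀ x ∈ S, x ≤ (tape w).length) :
    ∃ U ⊆ S, n < U.card ∧
      ∃ c, ∀ x ∈ U, ∀ y ∈ U, x < y → (leftLevels (ρ.flow x y)).ncard = c := by
  refine exists_subset_constant_on_pairs (v := 1) (hmax Q) hS (fun x _ y hy z hz hxy hyz => ?_)
    fun x hx y hy hxy => ?_
  · have hI : ρ.IsInterval x y := ⟨hxy, hlen y hy⟩
    exact Set.ncard_le_ncard (hρ.leftLevels_subset hI ⟨hyz, hlen z hz⟩)
      ((Set.finite_Iio _).subset (hρ.leftLevels_subset_Iio hI))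
  · have hI : ρ.IsInterval x y := ⟨hxy, hlen y hy⟩
    have hpos := hρ.ncard_leftLevels_pos hI
    have hle := (hρ.ncard_leftLevels_le hI).trans (hn.length_crossing_le hρ (hlen x hx))
    omega

theorem exists_subset_levels_eq {S : Finset ℕ} {n : ℕ} (hS : n ^ hmax Q < S.card)
    (hlen : ∀ x ∈ S, x ≤ (tape w).length) :
    ∃ U ⊆ S, n < U.card ∧ ∃ lo up, ∀ x ∈ U, ∀ y ∈ U, x < y →
      (ρ.IsInterval x up ∧ leftLevels (ρ.flow x y) = leftLevels (ρ.flow x up)) ∧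
        ρ.IsInterval lo y ∧ rightLevels (ρ.flow x y) = rightLevels (ρ.flow lo y) := by
  obtain ⟨U, hUS, hU, c, hc⟩ := hn.exists_subset_ncard_leftLevels_eq hρ hS hlen
  have hne : U.Nonempty := Finset.card_pos.1 (Nat.zero_lt_of_lt hU)
  refine ⟨U, hUS, hU, U.min' hne, U.max' hne, fun x hx y hy hxy => ?_⟩
  have hlo := U.min'_mem hne
  have hup := U.max'_mem hne
  have hlox := U.min'_le x hx
  have hyup := U.le_max' y hy
  have hloy := hlox.trans_lt hxy
  have hxup := hxy.trans_le hyup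
  have hy_len := hlen y (hUS hy)
  have hup_len := hlen _ (hUS hup)
  refine ⟨⟨⟨hxup, hup_len⟩, ?_⟩, ⟨hloy, hy_len⟩, ?_⟩
  · exact hρ.leftLevels_eq_of_ncard_eq ⟨hxy, hy_len⟩ hyup hup_len
      ((hc x hx y hy hxy).trans (hc x hx _ hup hxup).symm)
  · exact hρ.rightLevels_eq_of_ncard_eq ⟨hxy, hy_len⟩ hlox
      ((hc x hx y hy hxy).trans (hc _ hlo y hy hloy).symm)

theorem exists_isUniform_subset {S : Finset ℕ} {n : ℕ}
    (hS : (n * (4 * (Fintype.card Q + 1)) ^ hmax Q) ^ hmax Q < S.card)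
    (hlen : ∀ x ∈ S, x ≤ (tape w).length) : ∃ U ⊆ S, n < U.card ∧ ρ.IsUniform U := by
  obtain ⟨V, hVS, hV, lo, up, hlevels⟩ := hn.exists_subset_levels_eq hρ hS hlen
  obtain ⟨U, hUV, hU, htype⟩ := exists_subset_borderType_eq hV ρ lo up
  have hlenU : ∀ x ∈ U, x ≤ (tape w).length := fun x hx => hlen x (hVS (hUV hx))
  have hcross : ∀ x ∈ U, ∀ y ∈ U, ρ.crossing x = ρ.crossing y := fun x hx y hy =>
    hn.crossing_eq_of_borderType_eq hρ (hlenU x hx) (hlenU y hy) (htype x hx y hy)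
  refine ⟨U, hUV.trans hVS, hU, hlenU, hcross, ?_⟩
  intro x hx y hy x' hx' y' hy' hxy hxy'
  obtain ⟨⟨hxup, hleft⟩, hloy, hright⟩ := hlevels x (hUV hx) y (hUV hy) hxy
  obtain ⟨⟨hxup', hleft'⟩, hloy', hright'⟩ := hlevels x' (hUV hx') y' (hUV hy') hxy'
  refine hρ.flow_eq_of_levels_eq ⟨hxy, hlenU y hy⟩ ⟨hxy', hlenU y' hy'⟩
    (congrArg List.length (hcross x hx x' hx')) (congrArg List.length (hcross y hy y' hy')) ?_ ?_
  · rw [hleft, hleft']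
    exact hn.leftLevels_eq_of_borderType_eq hρ hxup hxup' (htype x hx x' hx')
  · rw [hright, hright']
    exact hn.rightLevels_eq_of_borderType_eq hρ hloy hloy' (htype y hy y' hy')

end Normalized

end Uniform

section Productive

variable {ρ : Run T w} {Z : Set (ℕ × ℕ)} {t : ℕ}

open Classical in
/-- The numbers of the productive transitions of `ρ ∣ Z`, that is, of those with nonempty
output. -/
noncomputable def productive (ρ : Run T w) (Z : Set (ℕ × ℕ)) : Finset ℕ :=
  (Finset.range ρ.len).filter fun t => (ρ.loc t ∈ Z ∧ ρ.loc (t + 1) ∈ Z) ∧ (ρ.rule t).out ≠ []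

theorem mem_productive : t ∈ ρ.productive Z ↔
    t < ρ.len ∧ (ρ.loc t ∈ Z ∧ ρ.loc (t + 1) ∈ Z) ∧ (ρ.rule t).out ≠ [] := by
  simp only [productive, Finset.mem_filter, Finset.mem_range]

theorem length_output_restrict_le (ρ : Run T w) (Z : Set (ℕ × ℕ)) :
    (outputOf (ρ.restrict Z)).length ≤ (ρ.productive Z).card * T.cmax := by
  classical
  have hsum : (outputOf (ρ.restrict Z)).length =
      ∑ t ∈ Finset.range ρ.len with ρ.loc t ∈ Z ∧ ρ.loc (t + 1) ∈ Z, (ρ.rule t).out.length := by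
    rw [outputOf, restrict, List.length_flatMap, List.map_map,
      ← List.sum_toFinset _ (List.nodup_range.filter _), List.toFinset_filter,
      List.toFinset_range]
    simp only [decide_eq_true_eq, Function.comp_apply]
  rw [hsum, ← Finset.sum_filter_ne_zero]
  refine (Finset.sum_le_card_nsmul _ _ T.cmax fun t ht => ?_).trans_eq ?_
  · have hlt : t < ρ.len := Finset.mem_range.1 (Finset.mem_filter.1 (Finset.mem_filter.1 ht).1).1
    exact Finset.le_sup (f := fun r : Rule Q α β => r.out.length) (ρ.step t hlt).1
  · rw [smul_eq_mul, Finset.filter_filter, productive]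
    simp only [ne_eq, List.length_eq_zero_iff]

theorem Normalized.card_productive_le [Fintype Q] (hn : ρ.Normalized) (hρ : ρ.Successful)
    (Z : Set (ℕ × ℕ)) : (ρ.productive Z).card ≤
      hmax Q * ((ρ.productive Z).image fun t => (ρ.conf t).head).card := by
  refine Finset.card_le_mul_card_image _ _ fun c _ =>
    (Finset.card_le_card fun t ht => ?_).trans (hn.card_reading_le hρ c)
  rw [Finset.mem_filter, mem_productive] at ht
  exact Finset.mem_filter.2 ⟨Finset.mem_range.2 ht.1.1, ht.2⟩

/- The cells next to the borders `x₁` and `x₂` are discarded; there are at most four of them. -/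
theorem Normalized.exists_productive_cells [Fintype Q] (hn : ρ.Normalized) (hρ : ρ.Successful)
    {x₁ x₂ : ℕ} {K : Set (ℕ × ℕ)}
    (hB : T.bound < (outputOf (ρ.restrict (K ∩ Set.Icc x₁ x₂ ×ˢ Set.univ))).length) :
    ∃ S : Finset ℕ, 2 ^ (3 * emax Q) < S.card ∧ ∀ x ∈ S, x₁ < x ∧ x + 1 < x₂ ∧
      ∃ t, ρ.loc t ∈ K ∧ ρ.loc (t + 1) ∈ K ∧ (ρ.conf t).head = x ∧ (ρ.rule t).out ≠ [] := by
  set Z := K ∩ Set.Icc x₁ x₂ ×ˢ Set.univ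
  set cells := (ρ.productive Z).image fun t => (ρ.conf t).head
  refine ⟨cells \ {x₁ - 1, x₁, x₂ - 1, x₂}, ?_, fun x hx => ?_⟩
  · have hlt : hmax Q * (2 ^ (3 * emax Q) + 4) < hmax Q * cells.card := by
      refine lt_of_lt_of_le (Nat.lt_of_mul_lt_mul_left (a := T.cmax) ?_)
        (hn.card_productive_le hρ Z)
      rw [← mul_assoc, mul_comm _ (ρ.productive Z).card]
      exact hB.trans_le (ρ.length_output_restrict_le Z)
    have hcells := Nat.lt_of_mul_lt_mul_left hlt
    have hfour := Finset.card_le_four (a := x₁ - 1) (b := x₁) (c := x₂ - 1) (d := x₂)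
    have hsdiff := Finset.le_card_sdiff ({x₁ - 1, x₁, x₂ - 1, x₂} : Finset ℕ) cells
    omega
  · simp only [cells, Finset.mem_sdiff, Finset.mem_image, Finset.mem_insert,
      Finset.mem_singleton, mem_productive] at hx
    obtain ⟨⟨t, ⟨ht, ⟨⟨htK, htI, -⟩, htK', -⟩, hout⟩, rfl⟩, hne⟩ := hx
    have hpos := hρ.pos_eq_ite ht.le
    simp only [loc, Set.mem_Icc] at htI
    refine ⟨?_, ?_, t, htK, htK', rfl, hout⟩ <;> split_ifs at hpos <;> omega

theorem mem_Icc_of_loc_mem_locInterval {i j : ℕ}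
    (h : ρ.loc t ∈ ρ.locInterval (ρ.loc i) (ρ.loc j)) : t ∈ Set.Icc i j := by
  obtain ⟨⟨i', t', hit, -, hi, ht⟩, ⟨t'', j', htj, -, ht', hj⟩⟩ := h
  rw [← ρ.loc_injective hi, ← ρ.loc_injective hj]
  exact ⟨ρ.loc_injective ht ▸ hit, ρ.loc_injective ht' ▸ htj⟩

end Productive

section ProductiveComponent

variable [Fintype Q]

/-- `C` is a component, with productive trace, of the idempotent loop `[a, d]`, and its anchor is
the `i`-th location of the run. -/
structure IsProductiveComponent (ρ : Run T w) (a d : ℕ) (C : Set ℕ) (i : ℕ) : Prop where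
  isIdempotentLoop : ρ.IsIdempotentLoop a d
  isComponent : ρ.IsComponent a d C
  anchor_eq : anchor a d C = ρ.loc i
  exists_trace : ∃ τ, ρ.IsTrace a d C τ ∧ outputOf τ ≠ []

namespace IsUniform

variable {ρ : Run T w} {U : Finset ℕ} (hU : ρ.IsUniform U) (hn : ρ.Normalized) (hρ : ρ.Successful)

include hU hn hρ

theorem exists_isProductiveComponent {a b c d t : ℕ} (ha : a ∈ U) (hb : b ∈ U) (hc : c ∈ U)
    (hd : d ∈ U) (hab : a < b) (hbc : b < c) (hcd : c < d) (ht : t < ρ.len)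
    (hin : ρ.Inside b c t) (hout : (ρ.rule t).out ≠ []) :
    ∃ C i, ρ.IsProductiveComponent a d C i ∧ i ≤ t ∧ ∀ k ∈ Set.Icc i t, ρ.Inside a d k := by
  have hI {x y : ℕ} (hy : y ∈ U) (hxy : x < y) : ρ.IsInterval x y := ⟨hxy, hU.le_length y hy⟩
  have hbd := hbc.trans hcd
  have had := hab.trans hbd
  have hab_eq := hU.flow_eq a ha b hb a ha d hd hab had
  have hbd_eq := hU.flow_eq b hb d hd a ha d hd hbd had
  have hcd_eq := hU.flow_eq c hc d hd a ha d hd hcd had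
  have hcyc := hρ.cyclicFlow (hI hb hab) (hI hd hbd) hab_eq hbd_eq
  obtain ⟨i, j, hij, htij⟩ := hρ.exists_intercepted (hI hd had) ht
    ⟨hab.le.trans hin.1, hin.2.trans hcd⟩
  have hp := hρ.even_level_iff_of_inside (hI hb hab) (hI hd hcd) (hI hd had) hab_eq hcd_eq hij
    htij hin
  exact ⟨_, i, ⟨hn.isIdempotentLoop hρ (hI hd had) (hU.crossing_eq a ha d hd) hcyc,
    hij.isComponent hρ (hI hd had) hcyc hp, hij.anchor_eq_loc hρ (hI hd had) hcyc hp,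
    hij.exists_trace hρ (hI hd had) hcyc hp htij hout⟩, htij.1,
    fun k hk => hij.2.2.1 k hk.1 (hk.2.trans_lt htij.2)⟩

/- Of two disjoint loops, only one can contain the transition number `i₁`. -/
theorem exists_isProductiveComponent_anchor_between {i₁ i₂ : ℕ} (hcard : 6 < U.card)
    (hi₂ : i₂ ≤ ρ.len)
    (hprod : ∀ x ∈ U, ∃ t ∈ Set.Ico i₁ i₂, (ρ.conf t).head = x ∧ (ρ.rule t).out ≠ []) :
    ∃ a ∈ U, ∃ d ∈ U, a < d ∧ ∃ C, ∃ i ∈ Set.Ioo i₁ i₂, ρ.IsProductiveComponent a d C i := by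
  obtain ⟨V, hVU, hV⟩ := Finset.exists_subset_card_eq (show 7 ≤ U.card from hcard)
  set x := V.orderEmbOfFin hV
  have hx (k : Fin 7) : x k ∈ U := hVU (V.orderEmbOfFin_mem hV k)
  have hcomponent {k₀ k₁ k₂ k₃ : Fin 7} (h₀₁ : k₀ < k₁) (h₁₂ : k₁ < k₂) (h₂₃ : k₂ < k₃) :
      ∃ C, ∃ i < i₂, ρ.IsProductiveComponent (x k₀) (x k₃) C i ∧
        (i ≤ i₁ → ρ.Inside (x k₀) (x k₃) i₁) := by
    obtain ⟨t, ht, hhead, hout⟩ := hprod _ (hx k₁)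
    obtain ⟨C, i, hC, hit, hin⟩ := hU.exists_isProductiveComponent hn hρ (hx k₀) (hx k₁) (hx k₂)
      (hx k₃) (x.strictMono h₀₁) (x.strictMono h₁₂) (x.strictMono h₂₃) (ht.2.trans_le hi₂)
      ⟨hhead.ge, hhead.trans_lt (x.strictMono h₁₂)⟩ hout
    exact ⟨C, i, hit.trans_lt ht.2, hC, fun hi => hin i₁ ⟨hi, ht.1⟩⟩
  obtain ⟨C, i, hi, hC, hin⟩ :=
    hcomponent (show (0 : Fin 7) < 1 by decide) (show 1 < 2 by decide) (show 2 < 3 by decide)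
  obtain ⟨C', i', hi', hC', hin'⟩ :=
    hcomponent (show (3 : Fin 7) < 4 by decide) (show 4 < 5 by decide) (show 5 < 6 by decide)
  rcases lt_or_ge i₁ i with h | h
  · exact ⟨_, hx 0, _, hx 3, x.strictMono (by decide), C, i, ⟨h, hi⟩, hC⟩
  rcases lt_or_ge i₁ i' with h' | h'
  · exact ⟨_, hx 3, _, hx 6, x.strictMono (by decide), C', i', ⟨h', hi'⟩, hC'⟩
  · exact absurd ((hin' h').1.trans_lt (hin h).2) (lt_irrefl _)

end IsUniform

end ProductiveComponent

end Run

theorem mainTheorem8_general {Q α β : Type*} [Fintype Q] (T : TwoWayTransducer Q α β)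
    (w : List α) (ρ : Run T w) (hρ : ρ.Successful) (hn : ρ.Normalized)
    (x₁ x₂ : ℕ) (hI : ρ.IsInterval x₁ x₂) (l₁ l₂ : ℕ × ℕ) (hK : ρ.Le l₁ l₂)
    (hB : T.bound <
      (outputOf (ρ.restrict (ρ.locInterval l₁ l₂ ∩ Set.Icc x₁ x₂ ×ˢ Set.univ))).length) :
    ∃ (a b : ℕ) (C : Set ℕ), ρ.IsIdempotentLoop a b ∧ ρ.IsComponent a b C ∧
      x₁ < a ∧ a < b ∧ b < x₂ ∧
      ρ.Lt l₁ (anchor a b C) ∧ ρ.Lt (anchor a b C) l₂ ∧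
      ∃ τ, ρ.IsTrace a b C τ ∧ outputOf τ ≠ [] := by
  obtain ⟨S, hcard, hS⟩ := hn.exists_productive_cells hρ hB
  obtain ⟨i₁, i₂, -, hi₂, rfl, rfl⟩ := hK
  have hbound := pow_le_two_pow_three_mul_pow (Fintype.card_pos_iff.2 ⟨T.start⟩) (hmax Q)
  obtain ⟨U, hUS, hU, hunif⟩ := hn.exists_isUniform_subset hρ (hbound.trans_lt hcard)
    fun x hx => ((Nat.lt_succ_self x).trans (hS x hx).2.1).le.trans hI.2
  obtain ⟨a, ha, d, hd, had, C, i, hi, hC⟩ :=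
    hunif.exists_isProductiveComponent_anchor_between hn hρ hU hi₂ fun x hx => by
      obtain ⟨-, -, t, ht, ht', hhead, hout⟩ := hS x (hUS hx)
      exact ⟨t, ⟨(Run.mem_Icc_of_loc_mem_locInterval ht).1,
        (Run.mem_Icc_of_loc_mem_locInterval ht').2⟩, hhead, hout⟩
  refine ⟨a, d, C, hC.isIdempotentLoop, hC.isComponent, (hS a (hUS ha)).1, had,
    (Nat.lt_succ_self d).trans (hS d (hUS hd)).2.1, ?_, ?_, hC.exists_trace⟩ <;> rw [hC.anchor_eq]
  · exact ⟨i₁, i, hi.1, hi.2.le.trans hi₂, rfl, rfl⟩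
  · exact ⟨i, i₂, hi.2, hi₂, rfl, rfl⟩

theorem mainTheorem8 {Q α β : Type*} [Fintype Q] (T : TwoWayTransducer Q α β)
    (hT : T.Functional) (w : List α) (ρ : Run T w) (hρ : ρ.Successful) (hn : ρ.Normalized)
    (x₁ x₂ : ℕ) (hI : ρ.IsInterval x₁ x₂) (l₁ l₂ : ℕ × ℕ) (hK : ρ.Le l₁ l₂)
    (hB : T.bound <
      (outputOf (ρ.restrict (ρ.locInterval l₁ l₂ ∩ Set.Icc x₁ x₂ ×ˢ Set.univ))).length) :
    ∃ (a b : ℕ) (C : Set ℕ), ρ.IsIdempotentLoop a b ∧ ρ.IsComponent a b C ∧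
      x₁ < a ∧ a < b ∧ b < x₂ ∧
      ρ.Lt l₁ (anchor a b C) ∧ ρ.Lt (anchor a b C) l₂ ∧
      ∃ τ, ρ.IsTrace a b C τ ∧ outputOf τ ≠ [] := by
  exact mainTheorem8_general T w ρ hρ hn x₁ x₂ hI l₁ l₂ hK hB
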